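/- Setting. Let $X,U,Y,Z$ be complex Banach spaces, $W$ a complex Hilbert space and $\alpha\ge 0$. Exosystem. Let $I$ be an index set ($I=\mathbb Z$ for an infinite-dimensional exosystem; $I$ may also be finite), $(\omega_k)_{k\in I}\subset\mathbb R$, $(n_k)_{k\in I}$ a bounded family of positive integers and $\{\phi_k^l: k\in I,\ 1\le l\le n_k\}$ an orthonormal basis of $W$. Put $P_kv=\sum_{l}\langle v,\phi_k^l\rangle\phi_k^l$, $S_kv=\sum_{l=1}^{n_k}\langle v,\phi_k^l\rangle(i\omega_k\phi_k^l+\phi_k^{l-1})$ with $\phi_k^0:=0$, $Sv=\sum_kS_kv$ on $\mathrm{Dom}(S)=\{v:\sum_k\|S_kv\|^2<\infty\}$, $$T_S(t)v=\sum_{k}e^{i\omega_kt}\sum_{l=1}^{n_k}\langle v,\phi_k^l\rangle\sum_{j=1}^{l}\tfrac{t^{l-j}}{(l-j)!}\phi_k^j$$ (the group generated by $S$), and, for $\beta\ge0$, $W_\beta=\{v\in W:\|v\|_\beta^2:=\sum_k(1+\omega_k^2)^\beta\|P_kv\|^2<\infty\}$. Controller. $\mathcal G_1:\mathrm{Dom}(\mathcal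 G_1)\subset Z\to Z$ generates a strongly continuous semigroup, $\mathcal G_2\in\mathcal L(Y,Z)$, and $K$ is a linear operator from a subspace $\mathrm{Dom}(K)\supset\mathrm{Dom}(\mathcal G_1)$ of $Z$ to $U$ that is bounded on $\mathrm{Dom}(\mathcal G_1)$ with the norm $\|(\mu_0-\mathcal G_1)\cdot\|$, $\mu_0\in\rho(\mathcal G_1)$. Perturbed plant. $\tilde A$ generates a strongly continuous semigroup on $X$; for a fixed $\lambda_0\in\rho(\tilde A)$ let $\tilde X_{1}=(\mathrm{Dom}(\tilde A),\|(\lambda_0-\tilde A)\cdot\|)$, let $\tilde X_{-1}$ be the completion of $(X,\|R(\lambda_0,\tilde A)\cdot\|)$, and let $\tilde A_{-1}:X\to\tilde X_{-1}$ be the continuous extension of $\tilde A$. Let $\tilde B\in\mathcal L(U,\tilde X_{-1})$, let $\tilde C:\mathrm{Dom}(\tilde C)\subset X\to Y$ be linear with $\mathrm{Dom}(\tilde A)\subset\mathrm{Dom}(\tilde C)$ and $\tilde C|_{\tilde X_1}$ bounded, and let $\tilde D\in\mathcal L(U,Y)$, $\tilde E\in\mathcal L(W,X)$, $\tilde F\in\mathcal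 L(W,Y)$. Assume $\mathrm{ran}(R(\lambda,\tilde A_{-1})\tilde B)\subset\mathrm{Dom}(\tilde C)$ and $\tilde CR(\lambda,\tilde A_{-1})\tilde B\in\mathcal L(U,Y)$ for $\lambda\in\rho(\tilde A)$. On $X_e=X\times Z$ let $$\tilde A_e=\begin{pmatrix}\tilde A_{-1}&\tilde BK\\ \mathcal G_2\tilde C&\mathcal G_1+\mathcal G_2\tilde DK\end{pmatrix},\quad \mathrm{Dom}(\tilde A_e)=\{(x,z)\in\mathrm{Dom}(\tilde C)\times\mathrm{Dom}(\mathcal G_1):\tilde A_{-1}x+\tilde BKz\in X\},$$ $\tilde B_e=(\tilde E,\mathcal G_2\tilde F)^T$, and $\tilde C_e=(\tilde C,\tilde DK)$ with domain $\mathrm{Dom}(\tilde C)\times\mathrm{Dom}(K)$. The class $\mathcal O$. $(\tilde A,\tilde B,\tilde C,\tilde D,\tilde E,\tilde F)\in\mathcal O$ means that, in addition, $i\omega_k\in\rho(\tilde A)$ for all $k\in I$; $\tilde A_e$ generates a strongly stable strongly continuous semigroup and $\tilde C_e$ is $\tilde A_e$-bounded; and there is $\Sigma\in\mathcal L(W_\alpha,X_e)$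 with $\Sigma(W_{\alpha+1})\subset\mathrm{Dom}(\tilde A_e)$ and $\Sigma S=\tilde A_e\Sigma+\tilde B_e$ on $W_{\alpha+1}$. Robustness. Let $\tilde T_e$ be the semigroup generated by $\tilde A_e$. The controller is robust with respect to the perturbations $(\tilde A,\dots,\tilde F)$ if for all $x_{e0}\in\mathrm{Dom}(\tilde A_e)$ and $v_0\in W_{\alpha+1}$ the state $x_e(t)=\tilde T_e(t)x_{e0}+\int_0^t\tilde T_e(t-s)\tilde B_eT_S(s)v_0\,ds$ lies in $\mathrm{Dom}(\tilde C_e)$ for $t\ge0$ and the regulation error $e(t)=\tilde C_ex_e(t)+\tilde FT_S(t)v_0$ satisfies $e(t)\to0$ as $t\to\infty$. Block operators. Operators between $X,U,Y,Z,W$ act componentwise on vectors. For $k\in I$ let $\Phi_k=(\phi_k^{n_k},\dots,\phi_k^1)^T$; let $J_G$ (depending on $k$) be the $n_k\times n_k$ block upper triangular operator on $\mathrm{Dom}(\mathcal G_1)^{n_k}$ with $i\omega_k-\mathcal G_1$ on the diagonal and $I$ on the first superdiagonal; let $\mathbb R(i\omega_k,\tilde A_{-1})$ be the block upper triangular operator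 with entries $(-1)^{j-i}R(i\omega_k,\tilde A_{-1})^{j-i+1}$ for $i\le j$, similarly $\mathbb R(i\omega_k,\tilde A)$; and let $\tilde{\mathbb P}(i\omega_k)=\tilde C\,\mathbb R(i\omega_k,\tilde A_{-1})\tilde B+\tilde D$. Claim. Assume $(\tilde A,\tilde B,\tilde C,\tilde D,\tilde E,\tilde F)\in\mathcal O$. For every $k\in I$ the equation $$J_G\vec z^k=\mathcal G_2\bigl(\tilde{\mathbb P}(i\omega_k)K\vec z^k+\tilde C\,\mathbb R(i\omega_k,\tilde A)\tilde E\Phi_k+\tilde F\Phi_k\bigr)$$ has a unique solution $\vec z^k\in\mathrm{Dom}(\mathcal G_1)^{n_k}$. The controller is robust with respect to the perturbations if and only if for every $k\in I$ this solution satisfies $$\tilde{\mathbb P}(i\omega_k)K\vec z^k+\tilde C\,\mathbb R(i\omega_k,\tilde A)\tilde E\Phi_k+\tilde F\Phi_k=0 .$$ -/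

import Mathlib

open Filter Topology

namespace OutputReg

noncomputable section

/-! ### Unbounded operators, semigroups, resolvents -/

section Operators

variable {X : Type*} [NormedAddCommGroup X] [NormedSpace ℂ X]

/-- `T` is a strongly continuous semigroup on `X`; only the values at times `t ≥ 0` matter. -/
structure IsC0Semigroup (T : ℝ → X →L[ℂ] X) : Prop where
  map_zero : T 0 = ContinuousLinearMap.id ℂ X
  map_add : ∀ s t : ℝ, 0 ≤ s → 0 ≤ t → T (s + t) = (T s).comp (T t)
  tendsto_zero : ∀ x : X, Tendsto (fun t : ℝ => T t x) (𝓝[>] 0) (𝓝 x)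

/-- The operator `A` (with its domain) generates the strongly continuous semigroup `T`:
`x ∈ Dom(A)` and `A x = y` iff `(T(t)x - x)/t → y` as `t → 0+`. -/
structure Generates (A : X →ₗ.[ℂ] X) (T : ℝ → X →L[ℂ] X) : Prop where
  semigroup : IsC0Semigroup T
  graph_iff : ∀ x y : X, (x, y) ∈ A.graph ↔
    Tendsto (fun t : ℝ => ((t : ℂ)⁻¹) • (T t x - x)) (𝓝[>] 0) (𝓝 y)

/-- Strong stability: `T(t)x → 0` as `t → ∞` for every `x`. -/
def StronglyStable (T : ℝ → X →L[ℂ] X) : Prop :=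
  ∀ x : X, Tendsto (fun t : ℝ => T t x) atTop (𝓝 0)

/-- The bounded operator `R` is the inverse of `lam - A : Dom(A) → X`. -/
structure IsResolvent (A : X →ₗ.[ℂ] X) (lam : ℂ) (R : X →L[ℂ] X) : Prop where
  mem_domain : ∀ x, R x ∈ A.domain
  right_inv : ∀ x, lam • R x - A ⟨R x, mem_domain x⟩ = x
  left_inv : ∀ x : A.domain, R (lam • (x : X) - A x) = x

/-- The resolvent set `ρ(A)`. -/
def resSet (A : X →ₗ.[ℂ] X) : Set ℂ := {lam | ∃ R : X →L[ℂ] X, IsResolvent A lam R}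

open Classical in
/-- The resolvent operator `R(lam, A) = (lam - A)⁻¹` for `lam ∈ ρ(A)` (and `0` otherwise). -/
def res (A : X →ₗ.[ℂ] X) (lam : ℂ) : X →L[ℂ] X :=
  if h : ∃ R : X →L[ℂ] X, IsResolvent A lam R then h.choose else 0

theorem isResolvent_res {A : X →ₗ.[ℂ] X} {lam : ℂ} (h : lam ∈ resSet A) :
    IsResolvent A lam (res A lam) := by
  have h' : ∃ R : X →L[ℂ] X, IsResolvent A lam R := h
  rw [res, dif_pos h']
  exact h'.choose_spec

/-! ### The extrapolation space `X₋₁` -/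

/-- The vector space `X`, to be equipped with the (semi)norm `‖R ·‖`. -/
def ResNormed (_R : X →L[ℂ] X) : Type _ := X

instance (R : X →L[ℂ] X) : AddCommGroup (ResNormed R) := inferInstanceAs (AddCommGroup X)
instance (R : X →L[ℂ] X) : Module ℂ (ResNormed R) := inferInstanceAs (Module ℂ X)

/-- `R`, as a linear map on `ResNormed R`. -/
def ResNormed.toX (R : X →L[ℂ] X) : ResNormed R →ₗ[ℂ] X := R.toLinearMap

instance (R : X →L[ℂ] X) : SeminormedAddCommGroup (ResNormed R) :=
  SeminormedAddCommGroup.induced (ResNormed R) X (ResNormed.toX R)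

instance (R : X →L[ℂ] X) : NormedSpace ℂ (ResNormed R) :=
  NormedSpace.induced ℂ (ResNormed R) X (ResNormed.toX R)

/-- `X₋₁`: the completion of `X` with respect to the norm `‖R(lam₀, A) ·‖`. -/
abbrev Xm1 (A : X →ₗ.[ℂ] X) (lam₀ : ℂ) : Type _ :=
  UniformSpace.Completion (ResNormed (res A lam₀))

/-- The canonical embedding `X → X₋₁`. -/
def embed (A : X →ₗ.[ℂ] X) (lam₀ : ℂ) : X →L[ℂ] Xm1 A lam₀ :=
  LinearMap.mkContinuous
    { toFun := fun x => ((show ResNormed (res A lam₀) from x : ResNormed (res A lam₀)) :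
        UniformSpace.Completion (ResNormed (res A lam₀)))
      map_add' := fun x y => UniformSpace.Completion.coe_add
        (α := ResNormed (res A lam₀)) x y
      map_smul' := fun c x => UniformSpace.Completion.coe_smul
        (X := ResNormed (res A lam₀)) c x }
    ‖res A lam₀‖
    (fun x => by
      refine le_trans (le_of_eq ?_) ((res A lam₀).le_opNorm x)
      exact UniformSpace.Completion.norm_coe (E := ResNormed (res A lam₀)) x)

theorem norm_embed (A : X →ₗ.[ℂ] X) (lam₀ : ℂ) (x : X) :
    ‖embed A lam₀ x‖ = ‖res A lam₀ x‖ :=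
  UniformSpace.Completion.norm_coe (E := ResNormed (res A lam₀)) x

theorem embed_injective {A : X →ₗ.[ℂ] X} {lam₀ : ℂ} (h : lam₀ ∈ resSet A) :
    Function.Injective (embed A lam₀) := by
  rw [injective_iff_map_eq_zero]
  intro x hx
  have h1 : res A lam₀ x = 0 := by
    rw [← norm_eq_zero, ← norm_embed, hx, norm_zero]
  have h2 := (isResolvent_res h).right_inv x
  have h3 : (⟨res A lam₀ x, (isResolvent_res h).mem_domain x⟩ : A.domain) = 0 :=
    Subtype.ext h1
  rw [h3, h1, LinearPMap.map_zero, smul_zero, sub_zero] at h2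
  exact h2.symm

/-- The extension `A₋₁ : X → X₋₁` of `A`: the continuous extension to `X` of the map
`x ↦ A x ∈ X ⊆ X₋₁`, which is defined on the dense subspace `Dom(A)` of `X`. -/
def Am1 (A : X →ₗ.[ℂ] X) (lam₀ : ℂ) : X →L[ℂ] Xm1 A lam₀ :=
  ((embed A lam₀).toLinearMap ∘ₗ A.toFun).extendOfNorm A.domain.subtype

/-- `R(lam, A₋₁) = (lam - A₋₁)⁻¹ : X₋₁ → X`. -/
def resm1 (A : X →ₗ.[ℂ] X) (lam₀ lam : ℂ) : Xm1 A lam₀ →L[ℂ] X :=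
  (lam • embed A lam₀ - Am1 A lam₀).inverse

end Operators

/-! ### The exosystem -/

/-- A block diagonal exosystem on the Hilbert space `W`: frequencies `ω k`, block sizes `n k ≥ 1`
that are uniformly bounded, and an orthonormal basis `φ k l`. The second index runs over
`Fin (n k)`, so that `φ ⟨k, 0⟩` is the eigenvector of the `k`-th Jordan block. The index set `κ`
is `ℤ` for an infinite-dimensional exosystem and a finite set for a finite-dimensional one. -/
structure Exosystem (κ W : Type*) [NormedAddCommGroup W] [InnerProductSpace ℂ W] where
  ω : κ → ℝ
  n : κ → ℕ
  n_pos : ∀ k, 0 < n k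
  n_bdd : ∃ N : ℕ, ∀ k, n k ≤ N
  φ : HilbertBasis (Σ k : κ, Fin (n k)) ℂ W

namespace Exosystem

variable {κ W : Type*} [NormedAddCommGroup W] [InnerProductSpace ℂ W] (exo : Exosystem κ W)

/-- The point `i ω_k` of the imaginary axis. -/
def freq (k : κ) : ℂ := Complex.I * (exo.ω k : ℂ)

/-- The orthogonal projection `P_k` onto the span of `φ k l`, `l = 1, …, n_k`. -/
def proj (k : κ) : W →L[ℂ] W :=
  ∑ l : Fin (exo.n k), (innerSL ℂ (exo.φ ⟨k, l⟩)).smulRight (exo.φ ⟨k, l⟩)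

/-- The Jordan block `S_k`. -/
def block (k : κ) : W →L[ℂ] W :=
  ∑ l : Fin (exo.n k), (innerSL ℂ (exo.φ ⟨k, l⟩)).smulRight
    (exo.freq k • exo.φ ⟨k, l⟩ +
      if 0 < (l : ℕ) then exo.φ ⟨k, ⟨(l : ℕ) - 1, lt_of_le_of_lt (Nat.sub_le _ _) l.2⟩⟩ else 0)

/-- `exo.flow t v = T_S(t) v`, where `T_S` is the group generated by the operator `S`. -/
def flow (t : ℝ) (v : W) : W :=
  ∑' k : κ, Complex.exp (exo.freq k * t) • ∑ l : Fin (exo.n k), inner ℂ (exo.φ ⟨k, l⟩) v •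
    ∑ j ∈ Finset.Iic l,
      ((t : ℂ) ^ ((l : ℕ) - (j : ℕ)) / (((l : ℕ) - (j : ℕ)).factorial : ℂ)) • exo.φ ⟨k, j⟩

/-- `Φ_k = (φ_k^{n_k}, …, φ_k^1)ᵀ`. -/
def Phi (k : κ) (i : Fin (exo.n k)) : W := exo.φ ⟨k, i.rev⟩

/-- The space `W_α`. -/
def Wsp (α : ℝ) : Submodule ℂ W where
  carrier := {v | Summable fun k => (1 + exo.ω k ^ 2) ^ α * ‖exo.proj k v‖ ^ 2}
  zero_mem' := by simp [summable_zero]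
  add_mem' := by
    intro a b ha hb
    have ha' : Summable fun k => (1 + exo.ω k ^ 2) ^ α * ‖exo.proj k a‖ ^ 2 := ha
    have hb' : Summable fun k => (1 + exo.ω k ^ 2) ^ α * ‖exo.proj k b‖ ^ 2 := hb
    refine Summable.of_nonneg_of_le (fun k => by positivity) (fun k => ?_)
      ((ha'.mul_left 2).add (hb'.mul_left 2))
    have h1 : ‖exo.proj k (a + b)‖ ≤ ‖exo.proj k a‖ + ‖exo.proj k b‖ := by
      rw [map_add]; exact norm_add_le _ _
    have h2 : ‖exo.proj k (a + b)‖ ^ 2 ≤ 2 * ‖exo.proj k a‖ ^ 2 + 2 * ‖exo.proj k b‖ ^ 2 := by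
      nlinarith [norm_nonneg (exo.proj k (a + b)), sq_nonneg (‖exo.proj k a‖ - ‖exo.proj k b‖)]
    have h3 : 0 ≤ (1 + exo.ω k ^ 2) ^ α := by positivity
    nlinarith [mul_le_mul_of_nonneg_left h2 h3]
  smul_mem' := by
    intro c a ha
    have ha' : Summable fun k => (1 + exo.ω k ^ 2) ^ α * ‖exo.proj k a‖ ^ 2 := ha
    refine (ha'.mul_left (‖c‖ ^ 2)).congr (fun k => ?_)
    rw [map_smul, norm_smul]
    ring

/-- The norm `‖·‖_α` of `W_α`. -/
def normW (α : ℝ) (v : W) : ℝ :=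
  √(∑' k, (1 + exo.ω k ^ 2) ^ α * ‖exo.proj k v‖ ^ 2)

open Classical in
theorem proj_basis (k : κ) (p : Σ k : κ, Fin (exo.n k)) :
    exo.proj k (exo.φ p) = if p.1 = k then exo.φ p else 0 := by
  have horth := orthonormal_iff_ite.mp exo.φ.orthonormal
  simp only [proj, _root_.sum_apply, ContinuousLinearMap.smulRight_apply,
    innerSL_apply_apply, horth]
  obtain ⟨j, m⟩ := p
  split_ifs with h
  · change j = k at h
    subst h
    rw [Finset.sum_eq_single m]
    · simp
    · intro l _ hl
      rw [if_neg, zero_smul]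
      intro h2
      exact hl (by simpa using h2)
    · simp
  · refine Finset.sum_eq_zero fun l _ => ?_
    rw [if_neg, zero_smul]
    intro h2
    exact h (congrArg Sigma.fst h2).symm

open Classical in
theorem proj_block (j k : κ) (v : W) :
    exo.proj k (exo.block j v) = if j = k then exo.block j v else 0 := by
  simp only [block, _root_.sum_apply, ContinuousLinearMap.smulRight_apply,
    innerSL_apply_apply, map_sum, map_smul, map_add]
  by_cases h : j = k
  · subst h
    simp only [if_true]
    refine Finset.sum_congr rfl fun l _ => ?_
    congr 1
    split_ifs <;> simp [proj_basis]
  · simp only [h, if_false]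
    refine Finset.sum_eq_zero fun l _ => ?_
    split_ifs <;> simp [proj_basis, h]

theorem norm_block_le (k : κ) (v : W) :
    ‖exo.block k v‖ ≤ exo.n k * ((|exo.ω k| + 1) * ‖exo.proj k v‖) := by
  have hone : ∀ p, ‖exo.φ p‖ = 1 := fun p => exo.φ.orthonormal.1 p
  have hc : ∀ l : Fin (exo.n k), ‖inner ℂ (exo.φ ⟨k, l⟩) v‖ ≤ ‖exo.proj k v‖ := by
    intro l
    have h1 : inner ℂ (exo.φ ⟨k, l⟩) v = inner ℂ (exo.φ ⟨k, l⟩) (exo.proj k v) := by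
      simp only [proj, _root_.sum_apply, ContinuousLinearMap.smulRight_apply,
        innerSL_apply_apply, inner_sum, inner_smul_right]
      rw [Finset.sum_eq_single l]
      · simp [hone]
      · intro m _ hm
        have : (⟨k, l⟩ : Σ k : κ, Fin (exo.n k)) ≠ ⟨k, m⟩ := by
          intro h2; exact hm (by simpa using h2.symm)
        rw [exo.φ.orthonormal.2 this, mul_zero]
      · simp
    rw [h1]
    refine (norm_inner_le_norm _ _).trans ?_
    rw [hone, one_mul]
  have hb : exo.block k v = ∑ l : Fin (exo.n k), inner ℂ (exo.φ ⟨k, l⟩) v •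
      (exo.freq k • exo.φ ⟨k, l⟩ + if 0 < (l : ℕ) then
        exo.φ ⟨k, ⟨(l : ℕ) - 1, lt_of_le_of_lt (Nat.sub_le _ _) l.2⟩⟩ else 0) := by
    simp [block]
  rw [hb]
  refine (norm_sum_le _ _).trans ?_
  have hterm : ∀ l ∈ (Finset.univ : Finset (Fin (exo.n k))),
      ‖inner ℂ (exo.φ ⟨k, l⟩) v • (exo.freq k • exo.φ ⟨k, l⟩ + if 0 < (l : ℕ) then
        exo.φ ⟨k, ⟨(l : ℕ) - 1, lt_of_le_of_lt (Nat.sub_le _ _) l.2⟩⟩ else 0)‖ ≤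
      (|exo.ω k| + 1) * ‖exo.proj k v‖ := by
    intro l _
    rw [norm_smul, mul_comm]
    refine mul_le_mul ?_ (hc l) (norm_nonneg _) (by positivity)
    refine (norm_add_le _ _).trans (add_le_add ?_ ?_)
    · rw [norm_smul, hone, mul_one, freq, norm_mul, Complex.norm_I, one_mul,
        Complex.norm_real, Real.norm_eq_abs]
    · split_ifs <;> simp [hone]
  refine (Finset.sum_le_sum hterm).trans ?_
  simp

theorem summable_block [CompleteSpace W] {v : W}
    (hv : Summable fun k => ‖exo.block k v‖ ^ 2) : Summable fun k => exo.block k v := by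
  let V : κ → Submodule ℂ W := fun k => LinearMap.range (exo.proj k).toLinearMap
  have hV : OrthogonalFamily ℂ (fun k => V k) fun k => (V k).subtypeₗᵢ := by
    refine OrthogonalFamily.of_pairwise ?_
    intro j k hjk
    rw [Function.onFun, Submodule.isOrtho_iff_inner_eq]
    rintro _ ⟨a, rfl⟩ _ ⟨b, rfl⟩
    simp only [proj, ContinuousLinearMap.coe_coe, _root_.sum_apply,
      ContinuousLinearMap.smulRight_apply, innerSL_apply_apply, inner_sum, sum_inner,
      inner_smul_left, inner_smul_right, Finset.mul_sum]
    refine Finset.sum_eq_zero fun l _ => Finset.sum_eq_zero fun m _ => ?_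
    rw [exo.φ.orthonormal.2]
    · simp
    · intro h2
      have := congrArg Sigma.fst h2
      simp_all
  have hmem : ∀ k, exo.block k v ∈ V k := fun k =>
    ⟨exo.block k v, by simp [proj_block]⟩
  exact (hV.summable_iff_norm_sq_summable (fun k => ⟨exo.block k v, hmem k⟩)).mpr hv

/-- The system operator `S v = ∑ S_k v` with `Dom(S) = {v | ∑ ‖S_k v‖² < ∞}`. -/
def S [CompleteSpace W] : W →ₗ.[ℂ] W where
  domain :=
    { carrier := {v | Summable fun k => ‖exo.block k v‖ ^ 2}
      zero_mem' := by simp [summable_zero]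
      add_mem' := by
        intro a b ha hb
        have ha' : Summable fun k => ‖exo.block k a‖ ^ 2 := ha
        have hb' : Summable fun k => ‖exo.block k b‖ ^ 2 := hb
        refine Summable.of_nonneg_of_le (fun k => by positivity) (fun k => ?_)
          ((ha'.mul_left 2).add (hb'.mul_left 2))
        have h1 : ‖exo.block k (a + b)‖ ≤ ‖exo.block k a‖ + ‖exo.block k b‖ := by
          rw [map_add]; exact norm_add_le _ _
        nlinarith [norm_nonneg (exo.block k (a + b)),
          sq_nonneg (‖exo.block k a‖ - ‖exo.block k b‖)]
      smul_mem' := by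
        intro c a ha
        have ha' : Summable fun k => ‖exo.block k a‖ ^ 2 := ha
        refine (ha'.mul_left (‖c‖ ^ 2)).congr (fun k => ?_)
        rw [map_smul, norm_smul]
        ring }
  toFun :=
    { toFun := fun v => ∑' k, exo.block k (v : W)
      map_add' := fun a b => by
        rw [← (exo.summable_block a.2).tsum_add (exo.summable_block b.2)]
        simp
      map_smul' := fun c a => by
        rw [RingHom.id_apply, ← (exo.summable_block a.2).tsum_const_smul c]
        simp }

theorem Wsp_succ_le (α : ℝ) : exo.Wsp (α + 1) ≤ exo.Wsp α := by
  intro v hv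
  have hv' : Summable fun k => (1 + exo.ω k ^ 2) ^ (α + 1) * ‖exo.proj k v‖ ^ 2 := hv
  refine Summable.of_nonneg_of_le (fun k => by positivity) (fun k => ?_) hv'
  refine mul_le_mul_of_nonneg_right ?_ (by positivity)
  exact Real.rpow_le_rpow_of_exponent_le (by nlinarith [sq_nonneg (exo.ω k)]) (by linarith)

/-- The weighted sums over the blocks of `S v` converge for `v ∈ W_{α+1}`. -/
theorem summable_weight_block (α : ℝ) {v : W} (hv : v ∈ exo.Wsp (α + 1)) :
    Summable fun k => (1 + exo.ω k ^ 2) ^ α * ‖exo.block k v‖ ^ 2 := by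
  obtain ⟨N, hN⟩ := exo.n_bdd
  have hv' : Summable fun k => (1 + exo.ω k ^ 2) ^ (α + 1) * ‖exo.proj k v‖ ^ 2 := hv
  refine Summable.of_nonneg_of_le (fun k => by positivity) (fun k => ?_)
    (hv'.mul_left ((N : ℝ) ^ 2 * 2))
  have h0 : (0 : ℝ) < 1 + exo.ω k ^ 2 := by positivity
  have h1 : ‖exo.block k v‖ ≤ N * ((|exo.ω k| + 1) * ‖exo.proj k v‖) := by
    refine (exo.norm_block_le k v).trans (mul_le_mul_of_nonneg_right ?_ (by positivity))
    exact_mod_cast hN k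
  have h2 : ‖exo.block k v‖ ^ 2 ≤ (N * ((|exo.ω k| + 1) * ‖exo.proj k v‖)) ^ 2 :=
    pow_le_pow_left₀ (norm_nonneg _) h1 2
  have h3 : (|exo.ω k| + 1) ^ 2 ≤ 2 * (1 + exo.ω k ^ 2) := by
    nlinarith [sq_nonneg (|exo.ω k| - 1), sq_abs (exo.ω k)]
  have h4 : ‖exo.block k v‖ ^ 2 ≤
      (N : ℝ) ^ 2 * 2 * ((1 + exo.ω k ^ 2) * ‖exo.proj k v‖ ^ 2) := by
    refine h2.trans ?_
    have h5 := mul_le_mul_of_nonneg_right h3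
      (by positivity : 0 ≤ (N : ℝ) ^ 2 * ‖exo.proj k v‖ ^ 2)
    nlinarith [h5]
  rw [Real.rpow_add h0, Real.rpow_one]
  have h6 := mul_le_mul_of_nonneg_left h4 (by positivity : 0 ≤ (1 + exo.ω k ^ 2) ^ α)
  nlinarith [h6]

theorem Wsp_le_domain [CompleteSpace W] {α : ℝ} (hα : 0 ≤ α) :
    exo.Wsp (α + 1) ≤ exo.S.domain := by
  intro v hv
  refine Summable.of_nonneg_of_le (fun k => by positivity) (fun k => ?_)
    (exo.summable_weight_block α hv)
  have h1 : 1 ≤ (1 + exo.ω k ^ 2) ^ α :=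
    Real.one_le_rpow (by nlinarith [sq_nonneg (exo.ω k)]) hα
  nlinarith [sq_nonneg ‖exo.block k v‖]

theorem S_mem_Wsp [CompleteSpace W] {α : ℝ} (hα : 0 ≤ α) {v : W} (hv : v ∈ exo.Wsp (α + 1)) :
    exo.S ⟨v, exo.Wsp_le_domain hα hv⟩ ∈ exo.Wsp α := by
  have hs : Summable fun k => exo.block k v :=
    exo.summable_block (exo.Wsp_le_domain hα hv)
  refine (exo.summable_weight_block α hv).congr fun k => ?_
  have h1 : exo.proj k (∑' j, exo.block j v) = exo.block k v := by
    rw [(exo.proj k).map_tsum hs, tsum_eq_single k]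
    · simp [proj_block]
    · intro j hj
      simp [proj_block, hj]
  change _ = (1 + exo.ω k ^ 2) ^ α * ‖exo.proj k (∑' j, exo.block j v)‖ ^ 2
  rw [h1]

end Exosystem

/-! ### The plant and the controller -/

/-- The parameters `(A, B, C, D, E, F)` of a plant together with the exosystem's input and output
operators, under the standing assumptions. `C` is a partially defined operator: its domain may be
larger than `Dom(A)`, and its restriction to `X₁ = (Dom(A), ‖(lam₀ - A)·‖)` is bounded. -/
structure Plant (X U Y W : Type*)
    [NormedAddCommGroup X] [NormedSpace ℂ X] [NormedAddCommGroup U] [NormedSpace ℂ U]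
    [NormedAddCommGroup Y] [NormedSpace ℂ Y] [NormedAddCommGroup W] [NormedSpace ℂ W] where
  A : X →ₗ.[ℂ] X
  generates : ∃ T, Generates A T
  lam₀ : ℂ
  lam₀_mem : lam₀ ∈ resSet A
  B : U →L[ℂ] Xm1 A lam₀
  C : X →ₗ.[ℂ] Y
  dom_A_le : A.domain ≤ C.domain
  C_bdd : ∃ M : ℝ, ∀ x : A.domain, ‖C ⟨x, dom_A_le x.2⟩‖ ≤ M * ‖lam₀ • (x : X) - A x‖
  D : U →L[ℂ] Y
  /-- `ran(R(lam, A₋₁) B) ⊆ Dom(C)` -/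
  ran_le : ∀ lam ∈ resSet A, ∀ u, resm1 A lam₀ lam (B u) ∈ C.domain
  /-- `C R(lam, A₋₁) B` is bounded -/
  CRB_bdd : ∀ lam, ∀ h : lam ∈ resSet A, ∃ M : ℝ, ∀ u,
    ‖C ⟨resm1 A lam₀ lam (B u), ran_le lam h u⟩‖ ≤ M * ‖u‖
  E : W →L[ℂ] X
  F : W →L[ℂ] Y

/-- A dynamic error feedback controller `(G₁, G₂, K)`, where `K` is bounded on
`Z₁ = (Dom(G₁), ‖(μ₀ - G₁)·‖)`. -/
structure Controller (Y U Z : Type*)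
    [NormedAddCommGroup Y] [NormedSpace ℂ Y] [NormedAddCommGroup U] [NormedSpace ℂ U]
    [NormedAddCommGroup Z] [NormedSpace ℂ Z] where
  G₁ : Z →ₗ.[ℂ] Z
  generates : ∃ T, Generates G₁ T
  G₂ : Y →L[ℂ] Z
  K : Z →ₗ.[ℂ] U
  dom_G₁_le : G₁.domain ≤ K.domain
  μ₀ : ℂ
  μ₀_mem : μ₀ ∈ resSet G₁
  K_bdd : ∃ M : ℝ, ∀ z : G₁.domain, ‖K ⟨z, dom_G₁_le z.2⟩‖ ≤ M * ‖μ₀ • (z : Z) - G₁ z‖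

section ClosedLoop

variable {X U Y W Z κ : Type*}
  [NormedAddCommGroup X] [NormedSpace ℂ X] [NormedAddCommGroup U] [NormedSpace ℂ U]
  [NormedAddCommGroup Y] [NormedSpace ℂ Y] [NormedAddCommGroup Z] [NormedSpace ℂ Z]
  [NormedAddCommGroup W] [InnerProductSpace ℂ W]

namespace Controller

/-- `K` on `Dom(G₁)`. -/
def Kdom (ctrl : Controller Y U Z) (z : ctrl.G₁.domain) : U :=
  ctrl.K ⟨z, ctrl.dom_G₁_le z.2⟩

/-- The block upper triangular operator with `lam - G₁` on the diagonal and identity operators on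
the first superdiagonal. -/
def JG (ctrl : Controller Y U Z) (lam : ℂ) {n : ℕ} (z : Fin n → ctrl.G₁.domain) (i : Fin n) : Z :=
  lam • (z i : Z) - ctrl.G₁ (z i) + if h : (i : ℕ) + 1 < n then (z ⟨(i : ℕ) + 1, h⟩ : Z) else 0

end Controller

namespace Plant

/-- `resPow lam m = R(lam, A₋₁)^(m+1) : X₋₁ → X`. After the first application of `R(lam, A₋₁)`
one is in `X`, where `R(lam, A₋₁)` coincides with `R(lam, A)`. -/
def resPow (P : Plant X U Y W) (lam : ℂ) (m : ℕ) : Xm1 P.A P.lam₀ →L[ℂ] X :=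
  ((res P.A lam) ^ m).comp (resm1 P.A P.lam₀ lam)

/-- The block operator `ℝ(lam, A₋₁)`, with entry `(-1)^(j-i) R(lam, A₋₁)^(j-i+1)` at `(i, j)`,
`i ≤ j`. -/
def blockResm1 (P : Plant X U Y W) (lam : ℂ) {n : ℕ} (x : Fin n → Xm1 P.A P.lam₀) (i : Fin n) :
    X :=
  ∑ j ∈ Finset.Ici i, (-1 : ℂ) ^ ((j : ℕ) - (i : ℕ)) • P.resPow lam ((j : ℕ) - (i : ℕ)) (x j)

/-- The block operator `ℝ(lam, A)`, with entry `(-1)^(j-i) R(lam, A)^(j-i+1)` at `(i, j)`,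
`i ≤ j`. -/
def blockRes (P : Plant X U Y W) (lam : ℂ) {n : ℕ} (x : Fin n → X) (i : Fin n) : X :=
  ∑ j ∈ Finset.Ici i,
    (-1 : ℂ) ^ ((j : ℕ) - (i : ℕ)) • ((res P.A lam) ^ ((j : ℕ) - (i : ℕ) + 1)) (x j)

theorem res_pow_mem (P : Plant X U Y W) {lam : ℂ} (h : lam ∈ resSet P.A) (m : ℕ) (x : X) :
    ((res P.A lam) ^ (m + 1)) x ∈ P.C.domain := by
  rw [pow_succ', _root_.mul_apply_eq_comp]
  exact P.dom_A_le ((isResolvent_res h).mem_domain _)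

theorem blockResm1_mem (P : Plant X U Y W) {lam : ℂ} (h : lam ∈ resSet P.A) {n : ℕ}
    (u : Fin n → U) (i : Fin n) :
    P.blockResm1 lam (fun j => P.B (u j)) i ∈ P.C.domain := by
  refine Submodule.sum_mem _ fun j _ => Submodule.smul_mem _ _ ?_
  rcases Nat.eq_zero_or_pos ((j : ℕ) - (i : ℕ)) with h0 | h0
  · rw [h0]
    simpa [resPow] using P.ran_le lam h (u j)
  · obtain ⟨m, hm⟩ := Nat.exists_eq_add_of_lt h0
    rw [hm, zero_add]
    exact P.res_pow_mem h m _

theorem blockRes_mem (P : Plant X U Y W) {lam : ℂ} (h : lam ∈ resSet P.A) {n : ℕ}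
    (x : Fin n → X) (i : Fin n) : P.blockRes lam x i ∈ P.C.domain :=
  Submodule.sum_mem _ fun _ _ => Submodule.smul_mem _ _ (P.res_pow_mem h _ _)

/-- The block operator `ℙ(lam) = C ℝ(lam, A₋₁) B + D` on `Uⁿ`; for `n = 1` this is the transfer
function `P(lam) = C R(lam, A₋₁) B + D`. -/
def blockTransfer (P : Plant X U Y W) {lam : ℂ} (h : lam ∈ resSet P.A) {n : ℕ}
    (u : Fin n → U) (i : Fin n) : Y :=
  P.C ⟨P.blockResm1 lam (fun j => P.B (u j)) i, P.blockResm1_mem h u i⟩ + P.D (u i)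

/-- The operator `C ℝ(lam, A)` on `Xⁿ`. -/
def blockCR (P : Plant X U Y W) {lam : ℂ} (h : lam ∈ resSet P.A) {n : ℕ}
    (x : Fin n → X) (i : Fin n) : Y :=
  P.C ⟨P.blockRes lam x i, P.blockRes_mem h x i⟩

/-- The graph of the closed-loop operator `A_e` on its maximal domain: the pairs
`((x, z), (x', z'))` with `x ∈ Dom(C)`, `z ∈ Dom(G₁)`,
`x' = A₋₁ x + B K z` (an identity in `X₋₁`) and `z' = G₂ C x + (G₁ + G₂ D K) z`. -/
def graphAe (P : Plant X U Y W) (ctrl : Controller Y U Z) :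
    Submodule ℂ ((X × Z) × (X × Z)) where
  carrier := {p | ∃ (hx : p.1.1 ∈ P.C.domain) (hz : p.1.2 ∈ ctrl.G₁.domain),
    embed P.A P.lam₀ p.2.1 = Am1 P.A P.lam₀ p.1.1 + P.B (ctrl.Kdom ⟨p.1.2, hz⟩) ∧
    p.2.2 = ctrl.G₂ (P.C ⟨p.1.1, hx⟩) +
      (ctrl.G₁ ⟨p.1.2, hz⟩ + ctrl.G₂ (P.D (ctrl.Kdom ⟨p.1.2, hz⟩)))}
  zero_mem' := by
    refine ⟨P.C.domain.zero_mem, ctrl.G₁.domain.zero_mem, ?_, ?_⟩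
    · have : ctrl.Kdom ⟨0, ctrl.G₁.domain.zero_mem⟩ = 0 := ctrl.K.map_zero
      simp [this]
    · have h1 : ctrl.Kdom ⟨0, ctrl.G₁.domain.zero_mem⟩ = 0 := ctrl.K.map_zero
      have h2 : ctrl.G₁ ⟨0, ctrl.G₁.domain.zero_mem⟩ = 0 := ctrl.G₁.map_zero
      have h3 : P.C ⟨0, P.C.domain.zero_mem⟩ = 0 := P.C.map_zero
      simp [h1, h2, h3]
  add_mem' := by
    rintro ⟨⟨x, z⟩, ⟨x', z'⟩⟩ ⟨⟨y, w⟩, ⟨y', w'⟩⟩ ⟨hx, hz, h1, h2⟩ ⟨hy, hw, h3, h4⟩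
    have hK : ctrl.Kdom ⟨z + w, ctrl.G₁.domain.add_mem hz hw⟩ =
        ctrl.Kdom ⟨z, hz⟩ + ctrl.Kdom ⟨w, hw⟩ :=
      ctrl.K.map_add ⟨z, ctrl.dom_G₁_le hz⟩ ⟨w, ctrl.dom_G₁_le hw⟩
    have hG : ctrl.G₁ ⟨z + w, ctrl.G₁.domain.add_mem hz hw⟩ =
        ctrl.G₁ ⟨z, hz⟩ + ctrl.G₁ ⟨w, hw⟩ := ctrl.G₁.map_add ⟨z, hz⟩ ⟨w, hw⟩
    have hC : P.C ⟨x + y, P.C.domain.add_mem hx hy⟩ = P.C ⟨x, hx⟩ + P.C ⟨y, hy⟩ :=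
      P.C.map_add ⟨x, hx⟩ ⟨y, hy⟩
    refine ⟨P.C.domain.add_mem hx hy, ctrl.G₁.domain.add_mem hz hw, ?_, ?_⟩
    · dsimp only [Prod.mk_add_mk] at h1 h3 ⊢
      rw [hK, map_add, map_add, map_add, h1, h3]
      abel
    · dsimp only [Prod.mk_add_mk] at h2 h4 ⊢
      rw [hK, hG, hC, h2, h4]
      simp only [map_add]
      abel
  smul_mem' := by
    rintro c ⟨⟨x, z⟩, ⟨x', z'⟩⟩ ⟨hx, hz, h1, h2⟩
    have hK : ctrl.Kdom ⟨c • z, ctrl.G₁.domain.smul_mem c hz⟩ = c • ctrl.Kdom ⟨z, hz⟩ :=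
      ctrl.K.map_smul c ⟨z, ctrl.dom_G₁_le hz⟩
    have hG : ctrl.G₁ ⟨c • z, ctrl.G₁.domain.smul_mem c hz⟩ = c • ctrl.G₁ ⟨z, hz⟩ :=
      ctrl.G₁.map_smul c ⟨z, hz⟩
    have hC : P.C ⟨c • x, P.C.domain.smul_mem c hx⟩ = c • P.C ⟨x, hx⟩ :=
      P.C.map_smul c ⟨x, hx⟩
    refine ⟨P.C.domain.smul_mem c hx, ctrl.G₁.domain.smul_mem c hz, ?_, ?_⟩
    · dsimp only [Prod.smul_mk] at h1 ⊢
      rw [hK, map_smul, map_smul, map_smul, h1, smul_add]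
    · dsimp only [Prod.smul_mk] at h2 ⊢
      rw [hK, hG, hC, h2]
      simp only [map_smul, smul_add]

/-- The closed-loop operator `A_e` on `X_e = X × Z`, with its maximal domain. -/
def Ae (P : Plant X U Y W) (ctrl : Controller Y U Z) : (X × Z) →ₗ.[ℂ] (X × Z) :=
  (P.graphAe ctrl).toLinearPMap

theorem graph_Ae (P : Plant X U Y W) (ctrl : Controller Y U Z) :
    (P.Ae ctrl).graph = P.graphAe ctrl := by
  refine Submodule.toLinearPMap_graph_eq _ ?_
  rintro ⟨⟨x, z⟩, ⟨x', z'⟩⟩ ⟨hx, hz, h1, h2⟩ h0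
  obtain ⟨rfl, rfl⟩ : x = 0 ∧ z = 0 := by simpa using h0
  have hK : ctrl.Kdom ⟨0, ctrl.G₁.domain.zero_mem⟩ = 0 := ctrl.K.map_zero
  have hG : ctrl.G₁ ⟨0, ctrl.G₁.domain.zero_mem⟩ = 0 := ctrl.G₁.map_zero
  have hC : P.C ⟨0, P.C.domain.zero_mem⟩ = 0 := P.C.map_zero
  dsimp only at h1 h2
  rw [hK, map_zero, map_zero, add_zero] at h1
  rw [hK, hG, hC] at h2
  refine Prod.ext ?_ ?_
  · exact embed_injective P.lam₀_mem (by rw [h1]; exact (map_zero _).symm)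
  · simpa using h2

/-- `B_e = (E, G₂ F)ᵀ`. -/
def Be (P : Plant X U Y W) (ctrl : Controller Y U Z) : W →L[ℂ] (X × Z) :=
  P.E.prod (ctrl.G₂.comp P.F)

/-- `C_e = (C, D K)` with domain `Dom(C) × Dom(K)`. -/
def Ce (P : Plant X U Y W) (ctrl : Controller Y U Z) : (X × Z) →ₗ.[ℂ] Y where
  domain := P.C.domain.prod ctrl.K.domain
  toFun :=
    { toFun := fun p => P.C ⟨p.1.1, p.2.1⟩ + P.D (ctrl.K ⟨p.1.2, p.2.2⟩)
      map_add' := fun p q => by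
        have h1 := P.C.map_add ⟨p.1.1, p.2.1⟩ ⟨q.1.1, q.2.1⟩
        have h2 := ctrl.K.map_add ⟨p.1.2, p.2.2⟩ ⟨q.1.2, q.2.2⟩
        have h3 := congrArg P.D h2
        rw [map_add] at h3
        refine (congrArg₂ (· + ·) h1 h3).trans ?_
        abel
      map_smul' := fun c p => by
        have h1 := P.C.map_smul c ⟨p.1.1, p.2.1⟩
        have h2 := ctrl.K.map_smul c ⟨p.1.2, p.2.2⟩
        have h3 := congrArg P.D h2
        rw [map_smul] at h3
        refine (congrArg₂ (· + ·) h1 h3).trans ?_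
        rw [RingHom.id_apply, smul_add] }

/-- `Sig ∈ L(W_α, X_e)` maps `W_{α+1}` into `Dom(A_e)` and solves the Sylvester equation
`Sig S = A_e Sig + B_e` on `W_{α+1}`. -/
structure SolvesSylvester [CompleteSpace W] (P : Plant X U Y W) (ctrl : Controller Y U Z)
    (exo : Exosystem κ W) {α : ℝ} (hα : 0 ≤ α) (Sig : exo.Wsp α →ₗ[ℂ] (X × Z)) : Prop where
  bdd : ∃ M : ℝ, ∀ v : exo.Wsp α, ‖Sig v‖ ≤ M * exo.normW α v
  mem_domain : ∀ v (hv : v ∈ exo.Wsp (α + 1)),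
    Sig ⟨v, exo.Wsp_succ_le α hv⟩ ∈ (P.Ae ctrl).domain
  eqn : ∀ v (hv : v ∈ exo.Wsp (α + 1)),
    Sig ⟨exo.S ⟨v, exo.Wsp_le_domain hα hv⟩, exo.S_mem_Wsp hα hv⟩ =
      P.Ae ctrl ⟨Sig ⟨v, exo.Wsp_succ_le α hv⟩, mem_domain v hv⟩ + P.Be ctrl v

/-- The class `𝒪` of admissible (perturbed) parameters `(A, B, C, D, E, F)`, for a given
controller, exosystem and `α`. -/
structure InClassO [CompleteSpace W] (P : Plant X U Y W) (ctrl : Controller Y U Z)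
    (exo : Exosystem κ W) {α : ℝ} (hα : 0 ≤ α) : Prop where
  freq_mem : ∀ k, exo.freq k ∈ resSet P.A
  stable : ∃ T, Generates (P.Ae ctrl) T ∧ StronglyStable T
  dom_le : (P.Ae ctrl).domain ≤ (P.Ce ctrl).domain
  rel_bdd : ∃ a b : ℝ, ∀ x : (P.Ae ctrl).domain,
    ‖P.Ce ctrl ⟨x, dom_le x.2⟩‖ ≤ a * ‖P.Ae ctrl x‖ + b * ‖(x : X × Z)‖
  sylvester : ∃ Sig : exo.Wsp α →ₗ[ℂ] (X × Z), P.SolvesSylvester ctrl exo hα Sig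

/-- The state `x_e(t) = T_e(t) x₀ + ∫₀ᵗ T_e(t-s) B_e v(s) ds` of the closed-loop system driven by
the exosystem state `v(s) = T_S(s) v₀`. -/
def state (P : Plant X U Y W) (ctrl : Controller Y U Z) (exo : Exosystem κ W)
    (T : ℝ → (X × Z) →L[ℂ] (X × Z)) (x₀ : X × Z) (v₀ : W) (t : ℝ) : X × Z :=
  T t x₀ + ∫ s in (0 : ℝ)..t, T (t - s) (P.Be ctrl (exo.flow s v₀))

/-- The controller is robust with respect to the (perturbed) parameters `P`: for all initial states
`x₀ ∈ Dom(A_e)` and `v₀ ∈ W_{α+1}` the regulation error `e(t) = C_e x_e(t) + F v(t)` of the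
(perturbed) closed-loop system is defined for `t ≥ 0` and tends to zero as `t → ∞`. -/
def Robust (P : Plant X U Y W) (ctrl : Controller Y U Z) (exo : Exosystem κ W) (α : ℝ) : Prop :=
  ∀ T, Generates (P.Ae ctrl) T → ∀ x₀ ∈ (P.Ae ctrl).domain, ∀ v₀ ∈ exo.Wsp (α + 1),
    ∃ e : ℝ → Y,
      (∀ t, 0 ≤ t → ∃ h : P.state ctrl exo T x₀ v₀ t ∈ (P.Ce ctrl).domain,
        e t = P.Ce ctrl ⟨P.state ctrl exo T x₀ v₀ t, h⟩ + P.F (exo.flow t v₀)) ∧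
      Tendsto e atTop (𝓝 0)

/-- The vector `ℙ(iω_k) K z + C ℝ(iω_k, A) E Φ_k + F Φ_k` in `Y^{n_k}`. -/
def errorVec (P : Plant X U Y W) (ctrl : Controller Y U Z) (exo : Exosystem κ W) (k : κ)
    (h : exo.freq k ∈ resSet P.A) (z : Fin (exo.n k) → ctrl.G₁.domain) : Fin (exo.n k) → Y :=
  fun i => P.blockTransfer h (fun j => ctrl.Kdom (z j)) i +
    P.blockCR h (fun j => P.E (exo.Phi k j)) i + P.F (exo.Phi k i)

/-- The equation `J_G z = G₂ (ℙ(iω_k) K z + C ℝ(iω_k, A) E Φ_k + F Φ_k)`. -/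
def SolvesFreqEq (P : Plant X U Y W) (ctrl : Controller Y U Z) (exo : Exosystem κ W) (k : κ)
    (h : exo.freq k ∈ resSet P.A) (z : Fin (exo.n k) → ctrl.G₁.domain) : Prop :=
  ∀ i, ctrl.JG (exo.freq k) z i = ctrl.G₂ (P.errorVec ctrl exo k h z i)

end Plant

end ClosedLoop

end

end OutputReg

namespace OutputReg

/-! ### Strongly continuous semigroups and their generators. -/

section Semigroup

/-! The Sylvester solution Σ makes the forced response explicit. Since ΣS = A_eΣ + B_e, the function
ΣT_S(t)v₀ is a particular solution of the closed-loop equation, so x_e(t) = T_e(t)(x₀ - Σv₀) +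
ΣT_S(t)v₀ (`state_eq`). Duhamel's formula gives this on basis vectors; boundedness of both sides in
the norm of W_α gives it on all of W_α (`eq_zero_of_basis`).

Hence e(t) = C_eT_e(t)(x₀ - Σv₀) + (C_eΣ + F)T_S(t)v₀. The first term tends to zero, because C_e is
A_e-bounded and A_e commutes with the strongly stable semigroup. The second has no reason to decay:
T_S only rotates the eigenvector of each Jordan block, so by induction along the chain its
convergence to zero forces C_eΣ + F to vanish on every basis vector, and then on W_{α+1}. Robustness
is therefore the identity C_eΣ + F = 0 (`robust_iff`).

It remains to compute ΣΦ_k. On a Jordan chain the Sylvester equation is a finite block triangular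
system in X × Z. As iω_k lies in ρ(A), its X-row is solved for the plant component by the block
resolvent, and substitution turns the Z-row into the frequency equation (`chainSol_iff`). Existence
of z comes from Σ. Uniqueness holds because a strongly stable generator has no eigenvalue on the
imaginary axis (`ChainSol.unique`). So ΣΦ_k consists of the plant vector and z, and the error vector
is (C_eΣ + F)Φ_k (`errorVec_eq_errorOp`). -/

theorem tendsto_sub_nhdsGT (s : ℝ) : Tendsto (fun r => r - s) (𝓝[>] s) (𝓝[>] 0) := by
  refine tendsto_nhdsWithin_iff.mpr ⟨?_, ?_⟩
  · have : Tendsto (fun r => r - s) (𝓝 s) (𝓝 (s - s)) :=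
      (continuous_id.sub continuous_const).tendsto s
    rw [sub_self] at this
    exact this.mono_left nhdsWithin_le_nhds
  · filter_upwards [self_mem_nhdsWithin] with r hr
    exact Set.mem_Ioi.mpr (sub_pos.mpr (Set.mem_Ioi.mp hr))

variable {E : Type*} [NormedAddCommGroup E] [NormedSpace ℂ E] {T : ℝ → E →L[ℂ] E}

namespace IsC0Semigroup

theorem tendsto_zero_Ici (hT : IsC0Semigroup T) (x : E) :
    Tendsto (fun t : ℝ => T t x) (𝓝[≥] 0) (𝓝 x) := by
  have h := hT.tendsto_zero x
  have h0 : T 0 x = x := by rw [hT.map_zero]; rfl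
  have h1 : ContinuousWithinAt (fun t : ℝ => T t x) (Set.Ioi 0) 0 := by
    change Tendsto _ _ _
    simpa only [h0] using h
  have h2 := continuousWithinAt_Ioi_iff_Ici.mp h1
  change Tendsto _ _ _ at h2
  simpa only [h0] using h2

/-- Otherwise ‖T(t_n)‖ is unbounded along some t_n → 0, although each orbit T(t_n)x converges; this
contradicts the uniform boundedness principle. -/
theorem exists_bound_near_zero [CompleteSpace E] (hT : IsC0Semigroup T) :
    ∃ δ : ℝ, 0 < δ ∧ ∃ M : ℝ, 1 ≤ M ∧ ∀ t ∈ Set.Icc 0 δ, ‖T t‖ ≤ M := by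
  by_contra! hcon
  have h1 : ∀ n : ℕ, ∃ t ∈ Set.Icc (0 : ℝ) (1 / ((n : ℝ) + 1)), (n : ℝ) + 1 < ‖T t‖ := fun n =>
    hcon _ Nat.one_div_pos_of_nat _ (by simp)
  choose t ht hn using h1
  have ht0 : Tendsto t atTop (𝓝[≥] 0) := by
    refine tendsto_nhdsWithin_iff.mpr ⟨?_, Eventually.of_forall fun n => (ht n).1⟩
    exact squeeze_zero (fun n => (ht n).1) (fun n => (ht n).2)
      tendsto_one_div_add_atTop_nhds_zero_nat
  obtain ⟨C, hC⟩ := banach_steinhaus (g := fun n => T (t n)) fun x => by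
    obtain ⟨C, hC⟩ := ((hT.tendsto_zero_Ici x).comp ht0).norm.bddAbove_range
    exact ⟨C, fun n => hC ⟨n, rfl⟩⟩
  obtain ⟨n, hn'⟩ := exists_nat_gt C
  linarith [hn n, hC n]

/-- Cut [0, t] into pieces of length at most δ; by the semigroup law each costs one factor M. -/
theorem exists_bound [CompleteSpace E] (hT : IsC0Semigroup T) (a : ℝ) :
    ∃ M : ℝ, 0 ≤ M ∧ ∀ t ∈ Set.Icc 0 a, ‖T t‖ ≤ M := by
  obtain ⟨δ, hδ, M, hM, hb⟩ := hT.exists_bound_near_zero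
  have key : ∀ n : ℕ, ∀ t ∈ Set.Icc (0 : ℝ) (n * δ), ‖T t‖ ≤ M ^ n := by
    intro n
    induction n with
    | zero =>
      intro t ht
      obtain rfl : t = 0 := by simpa using ht
      rw [hT.map_zero, pow_zero]
      exact ContinuousLinearMap.norm_id_le
    | succ n ih =>
      intro t ht
      have hr : 0 ≤ min t δ := le_min ht.1 hδ.le
      have hs : 0 ≤ t - min t δ := sub_nonneg.mpr (min_le_left _ _)
      have hs' : t - min t δ ≤ n * δ := by
        have h2 := ht.2
        push_cast at h2
        rcases min_cases t δ with ⟨h, _⟩ | ⟨h, _⟩ <;> rw [h]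
        · rw [sub_self]; positivity
        · linarith
      have h1 := hT.map_add _ _ hs hr
      rw [sub_add_cancel] at h1
      rw [h1, pow_succ]
      exact (ContinuousLinearMap.opNorm_comp_le _ _).trans
        (mul_le_mul (ih _ ⟨hs, hs'⟩) (hb _ ⟨hr, min_le_right _ _⟩) (norm_nonneg _)
          (by positivity))
  obtain ⟨n, hn⟩ := exists_nat_gt (a / δ)
  refine ⟨M ^ n, by positivity, fun t ht => key n t ⟨ht.1, ht.2.trans ?_⟩⟩
  exact ((div_lt_iff₀ hδ).mp hn).le

/-- Joint continuity of `(t, x) ↦ T(t)x` on `[0, ∞) × E`. -/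
theorem tendsto_apply [CompleteSpace E] (hT : IsC0Semigroup T) {ι : Type*} {l : Filter ι}
    {τ : ι → ℝ} {t : ℝ} {u : ι → E} {x : E} (hτ : Tendsto τ l (𝓝 t))
    (hτ0 : ∀ᶠ i in l, 0 ≤ τ i) (ht : 0 ≤ t) (hu : Tendsto u l (𝓝 x)) :
    Tendsto (fun i => T (τ i) (u i)) l (𝓝 (T t x)) := by
  obtain ⟨M, hM, hb⟩ := hT.exists_bound (t + 1)
  have habs : Tendsto (fun i => |τ i - t|) l (𝓝[≥] 0) := by
    refine tendsto_nhdsWithin_iff.mpr ⟨?_, Eventually.of_forall fun i => abs_nonneg (τ i - t)⟩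
    simpa using (hτ.sub_const t).abs
  have h1 : Tendsto (fun i => M * ‖u i - x‖ + M * ‖T |τ i - t| x - x‖) l (𝓝 0) := by
    have h2 := (tendsto_iff_norm_sub_tendsto_zero.mp hu).const_mul M
    have h3 := (tendsto_iff_norm_sub_tendsto_zero.mp
      ((hT.tendsto_zero_Ici x).comp habs)).const_mul M
    simpa using h2.add h3
  rw [tendsto_iff_norm_sub_tendsto_zero]
  refine squeeze_zero' (Eventually.of_forall fun i => norm_nonneg _) ?_ h1
  filter_upwards [hτ0, hτ.eventually_le_const (lt_add_one t)] with i hi0 hi1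
  have hbi := hb _ ⟨hi0, hi1⟩
  have e1 : T (τ i) (u i) - T t x = T (τ i) (u i - x) + (T (τ i) x - T t x) := by
    rw [map_sub]; abel
  rw [e1]
  refine (norm_add_le _ _).trans (add_le_add ((T (τ i)).le_of_opNorm_le hbi _) ?_)
  -- Factoring out the smaller of the two times leaves T(|τ - t|)x - x, which is small by continuity
  -- at zero.
  rcases le_total t (τ i) with h | h
  · have e2 := hT.map_add t (τ i - t) ht (sub_nonneg.mpr h)
    rw [add_sub_cancel] at e2
    rw [abs_of_nonneg (sub_nonneg.mpr h), e2, ContinuousLinearMap.comp_apply, ← map_sub]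
    exact (T t).le_of_opNorm_le (hb _ ⟨ht, by linarith⟩) _
  · have e2 := hT.map_add (τ i) (t - τ i) hi0 (sub_nonneg.mpr h)
    rw [add_sub_cancel] at e2
    rw [abs_of_nonpos (sub_nonpos.mpr h), neg_sub, e2, ContinuousLinearMap.comp_apply,
      ← map_sub, map_sub, ← norm_neg, neg_sub, ← map_sub]
    exact (T (τ i)).le_of_opNorm_le hbi _

theorem continuousOn_sub_apply [CompleteSpace E] (hT : IsC0Semigroup T) {t : ℝ} {u : ℝ → E}
    (hu : ContinuousOn u (Set.Icc 0 t)) :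
    ContinuousOn (fun s => T (t - s) (u s)) (Set.Icc 0 t) := by
  intro s hs
  refine hT.tendsto_apply ?_ ?_ (sub_nonneg.mpr hs.2) (hu s hs)
  · exact ((continuous_const.sub continuous_id).continuousWithinAt (s := Set.Icc 0 t) (x := s))
  · filter_upwards [self_mem_nhdsWithin] with r hr
    exact sub_nonneg.mpr hr.2

/-- Negative times carry no information; truncating them gives an orbit continuous on all of ℝ, to
which the fundamental theorem of calculus applies directly. -/
theorem continuous_max_apply [CompleteSpace E] (hT : IsC0Semigroup T) (x : E) :
    Continuous fun s : ℝ => T (max s 0) x := by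
  rw [continuous_iff_continuousAt]
  intro s
  refine hT.tendsto_apply ?_ (Eventually.of_forall fun r => le_max_right _ _) (le_max_right _ _)
    tendsto_const_nhds
  exact ((continuous_id.max continuous_const).continuousAt (x := s))

end IsC0Semigroup

namespace Generates

variable {A : E →ₗ.[ℂ] E}

theorem graph_apply (hA : Generates A T) {x y : E} (h : (x, y) ∈ A.graph) {t : ℝ} (ht : 0 ≤ t) :
    (T t x, T t y) ∈ A.graph := by
  rw [hA.graph_iff] at h ⊢
  refine (((T t).continuous.tendsto y).comp h).congr' ?_
  filter_upwards [self_mem_nhdsWithin] with s hs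
  have h1 := hA.semigroup.map_add t s ht (le_of_lt hs)
  have h2 := hA.semigroup.map_add s t (le_of_lt hs) ht
  have h3 : T s (T t x) = T t (T s x) := by
    rw [← ContinuousLinearMap.comp_apply, ← ContinuousLinearMap.comp_apply, ← h1, ← h2, add_comm]
  simp [h3]

theorem apply_mem_domain (hA : Generates A T) {t : ℝ} (ht : 0 ≤ t) (x : A.domain) :
    T t x ∈ A.domain :=
  LinearPMap.mem_domain_of_mem_graph (hA.graph_apply (A.mem_graph x) ht)

theorem map_apply (hA : Generates A T) {t : ℝ} (ht : 0 ≤ t) (x : A.domain) :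
    A ⟨T t x, hA.apply_mem_domain ht x⟩ = T t (A x) := by
  obtain ⟨y, hy, hy'⟩ := A.mem_graph_iff.mp (hA.graph_apply (A.mem_graph x) ht)
  refine Eq.trans ?_ hy'
  congr 1
  exact Subtype.ext hy.symm

/-- The slope equals T(t - r) applied to the slope of u minus the generator quotient (T(r - s)u(s) -
u(s))/(r - s). Joint continuity gives the limit. Only right derivatives occur, since the generator
is a right derivative. -/
theorem hasDerivWithinAt_sub_apply [CompleteSpace E] (hA : Generates A T) {t s : ℝ} (hs : s < t)
    {u : ℝ → E} {u' y : E} (hu : HasDerivWithinAt u u' (Set.Ioi s) s) (hy : (u s, y) ∈ A.graph) :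
    HasDerivWithinAt (fun r => T (t - r) (u r)) (T (t - s) (u' - y)) (Set.Ioi s) s := by
  rw [hasDerivWithinAt_iff_tendsto_slope' Set.self_notMem_Ioi] at hu ⊢
  rw [hA.graph_iff] at hy
  have hmap := tendsto_sub_nhdsGT s
  have h1 := hu.sub (hy.comp hmap)
  have hτ : Tendsto (fun r => t - r) (𝓝[>] s) (𝓝 (t - s)) :=
    ((continuous_const.sub continuous_id).tendsto s).mono_left nhdsWithin_le_nhds
  have hlt : ∀ᶠ r in 𝓝[>] s, r < t := nhdsWithin_le_nhds (Iio_mem_nhds hs)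
  refine (hA.semigroup.tendsto_apply hτ (hlt.mono fun r hr => sub_nonneg.mpr hr.le)
    (sub_nonneg.mpr hs.le) h1).congr' ?_
  filter_upwards [hlt, self_mem_nhdsWithin] with r hr hr'
  have e2 := hA.semigroup.map_add (t - r) (r - s) (sub_nonneg.mpr hr.le)
    (sub_nonneg.mpr (le_of_lt hr'))
  rw [sub_add_sub_cancel] at e2
  have e3 : ((r - s : ℝ) : ℂ)⁻¹ • (T (r - s) (u s) - u s) = (r - s)⁻¹ • (T (r - s) (u s) - u s) := by
    rw [← Complex.ofReal_inv, Complex.coe_smul]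
  simp only [Function.comp_apply, slope, vsub_eq_sub]
  rw [e3, ← smul_sub, ContinuousLinearMap.map_smul_of_tower, e2, ContinuousLinearMap.comp_apply,
    ← map_sub]
  congr 2
  abel

/-- Duhamel's formula. -/
theorem integral_sub_apply [CompleteSpace E] (hA : Generates A T) {t : ℝ} (ht : 0 ≤ t)
    {u u' y : ℝ → E} (hu : ContinuousOn u (Set.Icc 0 t))
    (hu' : ∀ s ∈ Set.Ioo 0 t, HasDerivWithinAt u (u' s) (Set.Ioi s) s)
    (hy : ∀ s ∈ Set.Ioo 0 t, (u s, y s) ∈ A.graph)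
    (hc : ContinuousOn (fun s => u' s - y s) (Set.Icc 0 t)) :
    ∫ s in (0 : ℝ)..t, T (t - s) (u' s - y s) = u t - T t (u 0) := by
  rw [intervalIntegral.integral_eq_sub_of_hasDeriv_right_of_le ht
    (hA.semigroup.continuousOn_sub_apply hu)
    (fun s hs => hA.hasDerivWithinAt_sub_apply hs.2 (hu' s hs) (hy s hs))]
  · rw [sub_self, sub_zero, hA.semigroup.map_zero]; rfl
  · refine ContinuousOn.intervalIntegrable ?_
    rw [Set.uIcc_of_le ht]
    exact hA.semigroup.continuousOn_sub_apply hc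

/-- The averages r⁻¹∫₀ʳ T(s)x ds tend to x. The integrals F(h) lie in the domain because T(r)F(h) -
F(h) = (F(h + r) - F(h)) - F(r), whose quotient by r converges. -/
theorem dense_domain [CompleteSpace E] (hA : Generates A T) : Dense (A.domain : Set E) := by
  intro x
  set f : ℝ → E := fun s => T (max s 0) x with hf
  have hfc : Continuous f := hA.semigroup.continuous_max_apply x
  set F : ℝ → E := fun h => ∫ s in (0 : ℝ)..h, f s with hF
  have hint : ∀ a b, IntervalIntegrable f MeasureTheory.volume a b := fun a b =>
    hfc.intervalIntegrable a b
  have hder : ∀ h, Tendsto (fun r : ℝ => r⁻¹ • (F (h + r) - F h)) (𝓝[>] 0) (𝓝 (f h)) := fun h =>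
    (hasDerivAt_iff_tendsto_slope_zero.mp (hfc.integral_hasStrictDerivAt 0 h).hasDerivAt).mono_left
      (nhdsWithin_mono _ fun r hr => ne_of_gt hr)
  have hmem : ∀ h, 0 ≤ h → F h ∈ A.domain := by
    intro h hh
    have hg : (F h, f h - f 0) ∈ A.graph := by
      rw [hA.graph_iff]
      refine ((hder h).sub (hder 0)).congr' ?_
      filter_upwards [self_mem_nhdsWithin] with r hr
      have hr0 : (0 : ℝ) ≤ r := le_of_lt hr
      have e1 : T r (F h) = F (h + r) - F r := by
        have e2 : T r (F h) = ∫ s in (0 : ℝ)..h, T r (f s) :=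
          ((T r).intervalIntegral_comp_comm (hint 0 h)).symm
        have e3 : ∫ s in (0 : ℝ)..h, T r (f s) = ∫ s in (0 : ℝ)..h, f (s + r) := by
          refine intervalIntegral.integral_congr fun s hs => ?_
          rw [Set.uIcc_of_le hh] at hs
          have e4 := hA.semigroup.map_add r s hr0 hs.1
          simp only [hf, max_eq_left hs.1, max_eq_left (add_nonneg hs.1 hr0)]
          rw [add_comm s r, e4]
          rfl
        rw [e2, e3, intervalIntegral.integral_comp_add_right, zero_add,
          ← intervalIntegral.integral_interval_sub_left (hint 0 _) (hint 0 _)]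
      have e0 : F 0 = 0 := intervalIntegral.integral_same
      rw [e1, ← Complex.ofReal_inv, Complex.coe_smul, ← smul_sub, zero_add, e0]
      congr 1
      abel
    exact LinearPMap.mem_domain_of_mem_graph hg
  have hlim := hder 0
  have e0 : F 0 = 0 := intervalIntegral.integral_same
  have f0 : f 0 = x := by simp [hf, hA.semigroup.map_zero]
  rw [f0] at hlim
  refine mem_closure_of_tendsto hlim ?_
  filter_upwards [self_mem_nhdsWithin] with r hr
  rw [zero_add, e0, sub_zero, ← Complex.coe_smul]
  exact A.domain.smul_mem _ (hmem r (le_of_lt hr))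

theorem hasDerivWithinAt_apply (hA : Generates A T) {x y : E} (h : (x, y) ∈ A.graph) {s : ℝ}
    (hs : 0 ≤ s) : HasDerivWithinAt (fun r => T r x) (T s y) (Set.Ioi s) s := by
  have h1 := hA.graph_apply h hs
  rw [hA.graph_iff] at h1
  rw [hasDerivWithinAt_iff_tendsto_slope' Set.self_notMem_Ioi]
  have hmap := tendsto_sub_nhdsGT s
  refine (h1.comp hmap).congr' ?_
  filter_upwards [self_mem_nhdsWithin] with r hr
  have e2 := hA.semigroup.map_add (r - s) s (sub_nonneg.mpr (le_of_lt hr)) hs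
  rw [sub_add_cancel] at e2
  simp only [Function.comp_apply, slope, vsub_eq_sub]
  rw [e2, ← Complex.ofReal_inv, Complex.coe_smul]
  rfl

/-- A generator determines its semigroup. -/
theorem apply_unique [CompleteSpace E] {T' : ℝ → E →L[ℂ] E} (hA : Generates A T)
    (hA' : Generates A T') {t : ℝ} (ht : 0 ≤ t) : T t = T' t := by
  refine ContinuousLinearMap.ext fun x => ?_
  refine congrFun ((T t).continuous.ext_on hA.dense_domain (T' t).continuous fun x hx => ?_) x
  have hg : (x, A ⟨x, hx⟩) ∈ A.graph := A.mem_graph ⟨x, hx⟩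
  -- The orbit T'(s)x solves u' = Au, so Duhamel's formula for T has zero forcing and gives T'(t)x =
  -- T(t)x.
  have h1 := hA.integral_sub_apply ht (u := fun s => T' s x) (u' := fun s => T' s (A ⟨x, hx⟩))
    (y := fun s => T' s (A ⟨x, hx⟩)) ?_
    (fun s hs => hA'.hasDerivWithinAt_apply hg hs.1.le)
    (fun s hs => hA'.graph_apply hg hs.1.le) (by simpa using continuousOn_const)
  · simp only [sub_self, map_zero, intervalIntegral.integral_zero, hA'.semigroup.map_zero] at h1
    exact (sub_eq_zero.mp h1.symm).symm
  · refine (hA'.semigroup.continuous_max_apply x).continuousOn.congr fun s hs => ?_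
    simp only [max_eq_left hs.1]

/-- The generator of a strongly stable semigroup has no eigenvalues on the imaginary axis. -/
theorem eq_zero_of_stable [CompleteSpace E] (hA : Generates A T) (hs : StronglyStable T) {w : ℝ}
    {x : E} (h : (x, (Complex.I * w) • x) ∈ A.graph) : x = 0 := by
  have h1 : ∀ t : ℝ, 0 ≤ t → T t x = Complex.exp (Complex.I * w * t) • x := by
    intro t ht
    have hd : ∀ s : ℝ, HasDerivAt (fun s : ℝ => Complex.exp (Complex.I * w * s) • x)
        ((Complex.exp (Complex.I * w * s) * (Complex.I * w)) • x) s := by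
      intro s
      have h2 : HasDerivAt (fun s : ℝ => Complex.I * w * (s : ℂ)) (Complex.I * w) s := by
        simpa using (Complex.ofRealCLM.hasDerivAt (x := s)).const_mul (Complex.I * w)
      exact h2.cexp.smul_const x
    -- Again zero forcing: e^{iws}x solves u' = Au, hence is the orbit of x. Its norm is constant,
    -- so stability forces x = 0.
    have h2 := hA.integral_sub_apply ht (u := fun s : ℝ => Complex.exp (Complex.I * w * s) • x)
      (u' := fun s : ℝ => (Complex.exp (Complex.I * w * s) * (Complex.I * w)) • x)
      (y := fun s : ℝ => (Complex.exp (Complex.I * w * s) * (Complex.I * w)) • x)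
      (fun s _ => (hd s).continuousAt.continuousWithinAt)
      (fun s _ => (hd s).hasDerivWithinAt)
      (fun s _ => by
        have := A.graph.smul_mem (Complex.exp (Complex.I * w * s)) h
        rwa [Prod.smul_mk, smul_smul] at this) (by simpa using continuousOn_const)
    simp only [sub_self, map_zero, intervalIntegral.integral_zero, Complex.ofReal_zero, mul_zero,
      Complex.exp_zero, one_smul] at h2
    exact (sub_eq_zero.mp h2.symm).symm
  have h2 := (hs x).norm
  rw [norm_zero] at h2
  have h3 : Tendsto (fun _ : ℝ => ‖x‖) atTop (𝓝 0) := by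
    refine h2.congr' ?_
    filter_upwards [eventually_ge_atTop 0] with t ht
    rw [h1 t ht, norm_smul, mul_comm Complex.I, mul_right_comm, ← Complex.ofReal_mul,
      Complex.norm_exp_ofReal_mul_I, one_mul]
  exact norm_eq_zero.mp (tendsto_nhds_unique tendsto_const_nhds h3)

end Generates

end Semigroup

/-! ### The extrapolation space and the resolvent of A₋₁. -/

section Extrapolation

variable {X : Type*} [NormedAddCommGroup X] [NormedSpace ℂ X] {A : X →ₗ.[ℂ] X} {lam₀ lam : ℂ}

theorem denseRange_embed (A : X →ₗ.[ℂ] X) (lam₀ : ℂ) : DenseRange (embed A lam₀) :=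
  UniformSpace.Completion.denseRange_coe (α := ResNormed (res A lam₀))

/-- The identity RA = λ₀R - 1 on Dom(A) bounds A from the norm of X to that of X₋₁. This bound and
the density of Dom(A) make `extendOfNorm` a genuine extension. -/
theorem Am1_coe [CompleteSpace X] (hd : Dense (A.domain : Set X)) (h : lam₀ ∈ resSet A)
    (x : A.domain) : Am1 A lam₀ (x : X) = embed A lam₀ (A x) := by
  refine LinearMap.extendOfNorm_eq (f := (embed A lam₀).toLinearMap ∘ₗ A.toFun)
    (e := A.domain.subtype) ?_ ⟨‖lam₀‖ * ‖res A lam₀‖ + 1, fun x => ?_⟩ x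
  · rwa [DenseRange, Submodule.coe_subtype, Subtype.range_coe]
  · change ‖embed A lam₀ (A x)‖ ≤ _ * ‖(x : X)‖
    rw [norm_embed]
    have h1 : res A lam₀ (A x) = lam₀ • res A lam₀ x - x := by
      have h2 := (isResolvent_res h).left_inv x
      rw [map_sub, map_smul] at h2
      exact eq_sub_of_add_eq' (sub_eq_iff_eq_add.mp h2).symm
    rw [h1]
    refine (norm_sub_le _ _).trans ?_
    rw [norm_smul, add_mul, one_mul, mul_assoc]
    gcongr
    exact (res A lam₀).le_opNorm _

theorem smul_embed_sub_Am1_res [CompleteSpace X] (hd : Dense (A.domain : Set X))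
    (h₀ : lam₀ ∈ resSet A) (h : lam ∈ resSet A) (x : X) :
    (lam • embed A lam₀ - Am1 A lam₀) (res A lam x) = embed A lam₀ x := by
  have h1 := Am1_coe hd h₀ ⟨res A lam x, (isResolvent_res h).mem_domain x⟩
  have h2 := congrArg (embed A lam₀) ((isResolvent_res h).right_inv x)
  rw [map_sub, map_smul] at h2
  change lam • embed A lam₀ (res A lam x) - Am1 A lam₀ (res A lam x) = _
  rw [← h2, h1]

/-- On Dom(A) this is R(λ₀, A)(λ₀ - A)x = x; both sides are continuous in x. -/
theorem norm_smul_embed_sub_Am1 [CompleteSpace X] (hd : Dense (A.domain : Set X))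
    (h : lam₀ ∈ resSet A) (x : X) : ‖(lam₀ • embed A lam₀ - Am1 A lam₀) x‖ = ‖x‖ := by
  refine congrFun (Continuous.ext_on (s := (A.domain : Set X)) hd
    (lam₀ • embed A lam₀ - Am1 A lam₀).continuous.norm continuous_norm fun x hx => ?_) x
  have h1 := Am1_coe hd h ⟨x, hx⟩
  have h2 := (isResolvent_res h).left_inv ⟨x, hx⟩
  change ‖lam₀ • embed A lam₀ x - Am1 A lam₀ x‖ = ‖x‖
  rw [h1, ← map_smul, ← map_sub, norm_embed, h2]

/-- An isometry from a complete space has closed range, and this range contains the dense image of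
X. -/
theorem isInvertible_base [CompleteSpace X] (hd : Dense (A.domain : Set X))
    (h : lam₀ ∈ resSet A) : (lam₀ • embed A lam₀ - Am1 A lam₀).IsInvertible := by
  let J : X →ₗᵢ[ℂ] Xm1 A lam₀ :=
    { (lam₀ • embed A lam₀ - Am1 A lam₀).toLinearMap with
      norm_map' := norm_smul_embed_sub_Am1 hd h }
  have hsurj : Function.Surjective J := by
    rw [← Set.range_eq_univ, ← J.isometry.isClosedEmbedding.isClosed_range.closure_eq]
    refine Dense.closure_eq ((denseRange_embed A lam₀).mono ?_)
    rintro _ ⟨x, rfl⟩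
    exact ⟨res A lam₀ x, smul_embed_sub_Am1_res hd h h x⟩
  exact ⟨(LinearIsometryEquiv.ofSurjective J hsurj).toContinuousLinearEquiv, rfl⟩

theorem resolvent_identity {mu : ℂ} (h : lam ∈ resSet A) (h' : mu ∈ resSet A) (x : X) :
    res A lam x - res A mu x = (mu - lam) • res A lam (res A mu x) := by
  have h1 := (isResolvent_res h').right_inv x
  have h2 := (isResolvent_res h).left_inv ⟨res A mu x, (isResolvent_res h').mem_domain x⟩
  have h3 := congrArg (res A lam) h1
  rw [map_sub, map_smul] at h2 h3
  simp only at h2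
  rw [← h3, sub_smul]
  nth_rewrite 3 [← h2]
  abel

/-- Factor λ - A₋₁ = (λ₀ - A₋₁)(1 + (λ - λ₀)R(λ₀, A)); by the resolvent identity the last factor has
inverse 1 - (λ - λ₀)R(λ, A). Thus `resm1` is a true inverse on ρ(A), not the default value of
`inverse`. -/
theorem isInvertible_smul_embed_sub_Am1 [CompleteSpace X] (hd : Dense (A.domain : Set X))
    (h₀ : lam₀ ∈ resSet A) (h : lam ∈ resSet A) :
    (lam • embed A lam₀ - Am1 A lam₀).IsInvertible := by
  have h1 := isInvertible_base hd h₀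
  have h2 : (ContinuousLinearMap.id ℂ X + (lam - lam₀) • res A lam₀).IsInvertible := by
    refine ContinuousLinearMap.IsInvertible.of_inverse
      (g := ContinuousLinearMap.id ℂ X - (lam - lam₀) • res A lam) ?_ ?_
    · ext x
      have h3 := resolvent_identity h₀ h x
      simp only [ContinuousLinearMap.comp_apply, _root_.add_apply,
        _root_.sub_apply, _root_.smul_apply,
        ContinuousLinearMap.id_apply, map_sub, map_smul]
      rw [← h3]
      rw [add_sub_cancel, add_sub_cancel_right]
    · ext x
      have h3 := resolvent_identity h h₀ x
      simp only [ContinuousLinearMap.comp_apply, _root_.add_apply,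
        _root_.sub_apply, _root_.smul_apply,
        ContinuousLinearMap.id_apply, map_add, map_smul]
      have h4 : (lam - lam₀) • res A lam (res A lam₀ x) = res A lam₀ x - res A lam x := by
        rw [← neg_sub lam₀ lam, neg_smul, ← h3, neg_sub]
      rw [h4]
      simp only [smul_sub]
      abel
  have h3 : lam • embed A lam₀ - Am1 A lam₀ = (lam₀ • embed A lam₀ - Am1 A lam₀).comp
      (ContinuousLinearMap.id ℂ X + (lam - lam₀) • res A lam₀) := by
    ext x
    have h4 := smul_embed_sub_Am1_res hd h₀ h₀ x
    rw [ContinuousLinearMap.comp_apply, _root_.add_apply,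
      _root_.smul_apply, map_add, map_smul, h4]
    simp only [_root_.sub_apply, _root_.smul_apply,
      ContinuousLinearMap.id_apply, sub_smul]
    abel
  rw [h3]
  exact h1.comp h2

theorem resm1_embed [CompleteSpace X] (hd : Dense (A.domain : Set X))
    (h₀ : lam₀ ∈ resSet A) (h : lam ∈ resSet A) (x : X) :
    resm1 A lam₀ lam (embed A lam₀ x) = res A lam x := by
  rw [← smul_embed_sub_Am1_res hd h₀ h x]
  exact (isInvertible_smul_embed_sub_Am1 hd h₀ h).inverse_apply_self _

/-- `lam x - A₋₁ x = y` iff `x = R(lam, A₋₁) y`. -/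
theorem smul_embed_sub_Am1_eq_iff [CompleteSpace X] (hd : Dense (A.domain : Set X))
    (h₀ : lam₀ ∈ resSet A) (h : lam ∈ resSet A) {x : X} {y : Xm1 A lam₀} :
    lam • embed A lam₀ x - Am1 A lam₀ x = y ↔ x = resm1 A lam₀ lam y := by
  have hi := isInvertible_smul_embed_sub_Am1 hd h₀ h
  constructor
  · rintro rfl
    exact (hi.inverse_apply_self x).symm
  · rintro rfl
    exact hi.self_apply_inverse y

end Extrapolation

/-! ### The exosystem: block projections, weighted spaces, S and its flow. -/

namespace Exosystem

variable {κ W : Type*} [NormedAddCommGroup W] [InnerProductSpace ℂ W] (exo : Exosystem κ W)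

/-! ### The projections `P_k` -/

theorem proj_apply (k : κ) (v : W) :
    exo.proj k v = ∑ l, inner ℂ (exo.φ ⟨k, l⟩) v • exo.φ ⟨k, l⟩ := by
  simp [proj]

open Classical in
theorem proj_proj (j k : κ) (v : W) :
    exo.proj k (exo.proj j v) = if j = k then exo.proj j v else 0 := by
  rw [proj_apply exo j, map_sum]
  simp only [map_smul, proj_basis]
  split_ifs <;> simp

theorem norm_basis (p : Σ k : κ, Fin (exo.n k)) : ‖exo.φ p‖ = 1 := exo.φ.orthonormal.1 p

open Classical in
theorem inner_basis (p q : Σ k : κ, Fin (exo.n k)) :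
    inner ℂ (exo.φ p) (exo.φ q) = if p = q then (1 : ℂ) else 0 :=
  orthonormal_iff_ite.mp exo.φ.orthonormal p q

theorem norm_inner_le_norm_proj (k : κ) (l : Fin (exo.n k)) (v : W) :
    ‖inner ℂ (exo.φ ⟨k, l⟩) v‖ ≤ ‖exo.proj k v‖ := by
  classical
  have h1 : inner ℂ (exo.φ ⟨k, l⟩) v = inner ℂ (exo.φ ⟨k, l⟩) (exo.proj k v) := by
    rw [proj_apply, inner_sum, Finset.sum_eq_single l]
    · rw [inner_smul_right, inner_basis, if_pos rfl, mul_one]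
    · intro m _ hm
      rw [inner_smul_right, inner_basis, if_neg, mul_zero]
      intro h
      exact hm (by simpa using h.symm)
    · simp
  rw [h1]
  refine (norm_inner_le_norm _ _).trans ?_
  rw [norm_basis, one_mul]

/-- The ranges of the projections `P_k`. -/
noncomputable def blockSpace (k : κ) : Submodule ℂ W := LinearMap.range (exo.proj k).toLinearMap

theorem orthogonalFamily_blockSpace :
    OrthogonalFamily ℂ (fun k => exo.blockSpace k) fun k => (exo.blockSpace k).subtypeₗᵢ := by
  classical
  refine OrthogonalFamily.of_pairwise ?_
  intro j k hjk
  rw [Function.onFun, Submodule.isOrtho_iff_inner_eq]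
  rintro _ ⟨a, rfl⟩ _ ⟨b, rfl⟩
  simp only [ContinuousLinearMap.coe_coe, proj_apply, inner_sum, sum_inner, inner_smul_left,
    inner_smul_right]
  refine Finset.sum_eq_zero fun l _ => mul_eq_zero_of_right _ (Finset.sum_eq_zero fun m _ => ?_)
  rw [inner_basis, if_neg, mul_zero]
  · intro h
    exact hjk (by simpa using congrArg Sigma.fst h)

variable {exo} in
theorem summable_of_proj_eq [CompleteSpace W] {f : κ → W} (hf : ∀ k, exo.proj k (f k) = f k)
    (hs : Summable fun k => ‖f k‖ ^ 2) : Summable f :=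
  (exo.orthogonalFamily_blockSpace.summable_iff_norm_sq_summable
    (fun k => ⟨f k, f k, hf k⟩)).mpr hs

variable {exo} in
theorem hasSum_norm_sq_of_proj_eq {f : κ → W} (hf : ∀ k, exo.proj k (f k) = f k) {a : W}
    (ha : HasSum f a) : HasSum (fun k => ‖f k‖ ^ 2) (‖a‖ ^ 2) := by
  have h1 : Tendsto (fun s : Finset κ => ‖∑ k ∈ s, f k‖ ^ 2) atTop (𝓝 (‖a‖ ^ 2)) :=
    Tendsto.pow (Tendsto.norm ha) 2
  refine Tendsto.congr (fun s => ?_) h1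
  exact exo.orthogonalFamily_blockSpace.norm_sum (fun k => ⟨f k, f k, hf k⟩) s

variable {exo} in
theorem proj_of_hasSum {f : κ → W} (hf : ∀ k, exo.proj k (f k) = f k) {a : W}
    (ha : HasSum f a) (k : κ) : exo.proj k a = f k := by
  have h1 := ha.mapL (exo.proj k)
  refine h1.unique ?_
  have h2 : HasSum (fun j => exo.proj k (f j)) (exo.proj k (f k)) := by
    refine hasSum_single k fun j hj => ?_
    rw [← hf j, proj_proj, if_neg hj]
  rwa [hf k] at h2

/-- This is the basis expansion of v with its terms grouped into the finite blocks. -/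
theorem hasSum_proj (v : W) : HasSum (fun k => exo.proj k v) v := by
  refine (exo.φ.hasSum_repr v).sigma fun k => ?_
  rw [proj_apply]
  convert hasSum_fintype (fun l : Fin (exo.n k) => exo.φ.repr v ⟨k, l⟩ • exo.φ ⟨k, l⟩) using 1
  simp only [exo.φ.repr_apply_apply]

theorem hasSum_norm_sq_proj (v : W) : HasSum (fun k => ‖exo.proj k v‖ ^ 2) (‖v‖ ^ 2) :=
  by
  classical
  exact hasSum_norm_sq_of_proj_eq (fun k => by rw [proj_proj, if_pos rfl]) (exo.hasSum_proj v)

/-! ### The spaces `W_β` -/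

theorem normW_nonneg (β : ℝ) (v : W) : 0 ≤ exo.normW β v := Real.sqrt_nonneg _

theorem norm_le_normW {β : ℝ} (hβ : 0 ≤ β) {v : W} (hv : v ∈ exo.Wsp β) :
    ‖v‖ ≤ exo.normW β v := by
  refine Real.le_sqrt_of_sq_le ?_
  rw [← (exo.hasSum_norm_sq_proj v).tsum_eq]
  refine (exo.hasSum_norm_sq_proj v).summable.tsum_le_tsum (fun k => ?_) hv
  exact le_mul_of_one_le_left (by positivity)
    (Real.one_le_rpow (by nlinarith [sq_nonneg (exo.ω k)]) hβ)

-- The weight depends on k alone, so an estimate block by block, uniform in k, passes to every W_β.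
variable {exo} in
theorem mem_Wsp_of_norm_proj_le {β : ℝ} {v w : W} {c : ℝ}
    (h : ∀ k, ‖exo.proj k w‖ ≤ c * ‖exo.proj k v‖) (hv : v ∈ exo.Wsp β) : w ∈ exo.Wsp β := by
  refine Summable.of_nonneg_of_le (fun k => by positivity) (fun k => ?_) (Summable.mul_left (c ^ 2) hv)
  have h1 := pow_le_pow_left₀ (norm_nonneg _) (h k) 2
  have h2 : 0 ≤ (1 + exo.ω k ^ 2) ^ β := by positivity
  calc _ ≤ (1 + exo.ω k ^ 2) ^ β * (c * ‖exo.proj k v‖) ^ 2 := by gcongr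
    _ = _ := by ring

variable {exo} in
/-- Comparison of weighted norms; `β'` is either `β` or `β + 1` in the applications. -/
theorem normW_le_of_forall_le {β β' : ℝ} {v w : W} {c : ℝ} (hc : 0 ≤ c)
    (h : ∀ k, (1 + exo.ω k ^ 2) ^ β * ‖exo.proj k w‖ ^ 2 ≤
      c ^ 2 * ((1 + exo.ω k ^ 2) ^ β' * ‖exo.proj k v‖ ^ 2)) (hv : v ∈ exo.Wsp β') :
    exo.normW β w ≤ c * exo.normW β' v := by
  have hv' : Summable fun k => c ^ 2 * ((1 + exo.ω k ^ 2) ^ β' * ‖exo.proj k v‖ ^ 2) :=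
    Summable.mul_left (c ^ 2) hv
  have hw : Summable fun k => (1 + exo.ω k ^ 2) ^ β * ‖exo.proj k w‖ ^ 2 :=
    Summable.of_nonneg_of_le (fun k => by positivity) h hv'
  have h1 := hw.tsum_le_tsum h hv'
  rw [tsum_mul_left] at h1
  rw [normW, normW, ← Real.sqrt_sq hc, ← Real.sqrt_mul (sq_nonneg c)]
  exact Real.sqrt_le_sqrt h1

variable {exo} in
theorem normW_le_of_norm_proj_le {β : ℝ} {v w : W} {c : ℝ} (hc : 0 ≤ c)
    (h : ∀ k, ‖exo.proj k w‖ ≤ c * ‖exo.proj k v‖) (hv : v ∈ exo.Wsp β) :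
    exo.normW β w ≤ c * exo.normW β v := by
  refine normW_le_of_forall_le hc (fun k => ?_) hv
  have h1 := pow_le_pow_left₀ (norm_nonneg _) (h k) 2
  have h2 : 0 ≤ (1 + exo.ω k ^ 2) ^ β := by positivity
  calc _ ≤ (1 + exo.ω k ^ 2) ^ β * (c * ‖exo.proj k v‖) ^ 2 := by gcongr
    _ = _ := by ring

theorem normW_mono {β : ℝ} {v : W} (hv : v ∈ exo.Wsp (β + 1)) :
    exo.normW β v ≤ exo.normW (β + 1) v := by
  rw [← one_mul (exo.normW (β + 1) v)]
  refine normW_le_of_forall_le zero_le_one (fun k => ?_) hv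
  rw [one_pow, one_mul]
  gcongr
  · nlinarith [sq_nonneg (exo.ω k)]
  · linarith

theorem proj_mem_Wsp {β : ℝ} {v : W} (hv : v ∈ exo.Wsp β) (k : κ) :
    exo.proj k v ∈ exo.Wsp β := by
  refine mem_Wsp_of_norm_proj_le (c := 1) (fun j => ?_) hv
  rw [proj_proj, one_mul]
  split_ifs with h
  · rw [h]
  · rw [norm_zero]; exact norm_nonneg _

theorem basis_mem_Wsp (β : ℝ) (p : Σ k : κ, Fin (exo.n k)) : exo.φ p ∈ exo.Wsp β := by
  refine summable_of_ne_finset_zero (s := {p.1}) fun k hk => ?_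
  rw [proj_basis, if_neg fun h => hk (by simp [h])]
  simp

/-- The elements `φ_k^l` of `W_β`. -/
noncomputable def basisW (β : ℝ) (p : Σ k : κ, Fin (exo.n k)) : exo.Wsp β := ⟨exo.φ p, exo.basis_mem_Wsp β p⟩

variable {exo} in
/-- A linear operator that is bounded on `W_β` is determined by its values on the basis. -/
theorem eq_zero_of_basis {β : ℝ} {E : Type*} [NormedAddCommGroup E] [NormedSpace ℂ E]
    {L : exo.Wsp β →ₗ[ℂ] E} (hb : ∃ M : ℝ, ∀ v, ‖L v‖ ≤ M * exo.normW β v)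
    (h : ∀ p, L (exo.basisW β p) = 0) : L = 0 := by
  classical
  obtain ⟨M, hM⟩ := hb
  ext v
  set a : κ → ℝ := fun k => (1 + exo.ω k ^ 2) ^ β * ‖exo.proj k v‖ ^ 2 with ha
  have hv : Summable a := v.2
  let q : κ → exo.Wsp β := fun k => ⟨exo.proj k v, exo.proj_mem_Wsp v.2 k⟩
  have hq : ∀ k, L (q k) = 0 := by
    intro k
    have h1 : q k = ∑ l, inner ℂ (exo.φ ⟨k, l⟩) (v : W) • exo.basisW β ⟨k, l⟩ := by
      refine Subtype.ext ?_
      simp only [AddSubmonoidClass.coe_finsetSum, Submodule.coe_smul]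
      exact exo.proj_apply k v
    rw [h1, map_sum]
    exact Finset.sum_eq_zero fun l _ => by rw [map_smul, h, smul_zero]
  -- Removing finitely many blocks from v leaves exactly the tail of the series for its squared
  -- norm. Since L kills the removed blocks, ‖Lv‖ is at most M times the root of an arbitrarily
  -- small tail.
  have hn : ∀ s : Finset κ, exo.normW β (v - ∑ k ∈ s, q k : exo.Wsp β) =
      √(∑' k, a k - ∑ k ∈ s, a k) := by
    intro s
    rw [normW]
    congr 1
    have h1 : HasSum (fun k => a k - if k ∈ s then a k else 0) (∑' k, a k - ∑ k ∈ s, a k) := by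
      refine hv.hasSum.sub ?_
      have h2 : HasSum (fun k => if k ∈ s then a k else 0) (∑ k ∈ s, if k ∈ s then a k else 0) :=
        hasSum_sum_of_ne_finset_zero fun k hk => if_neg hk
      rwa [Finset.sum_congr rfl fun k hk => if_pos hk] at h2
    rw [← h1.tsum_eq]
    congr 1 with k
    have h2 : exo.proj k (v - ∑ j ∈ s, q j : exo.Wsp β) =
        if k ∈ s then 0 else exo.proj k v := by
      simp only [AddSubgroupClass.coe_sub, AddSubmonoidClass.coe_finsetSum, map_sub, map_sum, q,
        proj_proj, Finset.sum_ite_eq']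
      split_ifs <;> simp
    rw [h2]
    split_ifs <;> simp [ha]
  have ht : Tendsto (fun s : Finset κ => M * √(∑' k, a k - ∑ k ∈ s, a k)) atTop (𝓝 0) := by
    have h1 : Tendsto (fun s : Finset κ => ∑' k, a k - ∑ k ∈ s, a k) atTop (𝓝 0) := by
      simpa using (tendsto_const_nhds (x := ∑' k, a k)).sub hv.hasSum
    simpa using (h1.sqrt).const_mul M
  refine norm_le_zero_iff.mp (ge_of_tendsto ht (Eventually.of_forall fun s => ?_))
  have h1 := hM (v - ∑ k ∈ s, q k)
  rwa [map_sub, map_sum, Finset.sum_eq_zero fun k _ => hq k, sub_zero, hn] at h1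

/-! ### The operator `S` -/

theorem block_basis_of_ne {j k : κ} (h : j ≠ k) (l : Fin (exo.n k)) :
    exo.block j (exo.φ ⟨k, l⟩) = 0 := by
  classical
  simp only [block, _root_.sum_apply, ContinuousLinearMap.smulRight_apply, innerSL_apply_apply,
    inner_basis]
  refine Finset.sum_eq_zero fun m _ => ?_
  rw [if_neg fun h' => h (congrArg Sigma.fst h'), zero_smul]

theorem block_basis (k : κ) (l : Fin (exo.n k)) :
    exo.block k (exo.φ ⟨k, l⟩) = exo.freq k • exo.φ ⟨k, l⟩ +
      if 0 < (l : ℕ) then exo.φ ⟨k, ⟨(l : ℕ) - 1, lt_of_le_of_lt (Nat.sub_le _ _) l.2⟩⟩ else 0 := by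
  classical
  simp only [block, _root_.sum_apply, ContinuousLinearMap.smulRight_apply, innerSL_apply_apply,
    inner_basis]
  rw [Finset.sum_eq_single l]
  · rw [if_pos rfl, one_smul]
  · intro m _ hm
    rw [if_neg, zero_smul]
    intro h
    exact hm (by simpa using h)
  · simp

section S

variable [CompleteSpace W]

theorem proj_S (v : exo.S.domain) (k : κ) : exo.proj k (exo.S v) = exo.block k (v : W) :=
  proj_of_hasSum (f := fun k => exo.block k (v : W)) (fun k => by simp [proj_block])
    (exo.summable_block v.2).hasSum k

/-- On block k the operator S costs a factor of order |ω_k| + 1, which the extra weight 1 + ω_k²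
absorbs. This later bounds A_eΣ = ΣS - B_e on W_{α+1}. -/
theorem exists_normW_S_le {α : ℝ} (hα : 0 ≤ α) : ∃ c : ℝ, ∀ v (hv : v ∈ exo.Wsp (α + 1)),
    exo.normW α (exo.S ⟨v, exo.Wsp_le_domain hα hv⟩) ≤ c * exo.normW (α + 1) v := by
  obtain ⟨N, hN⟩ := exo.n_bdd
  -- N bounds the block sizes; the 2 is the root of the 4 in (|ω| + 1)² ≤ 4(1 + ω²).
  refine ⟨N * 2, fun v hv => normW_le_of_forall_le (by positivity) (fun k => ?_) hv⟩
  rw [proj_S]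
  have h0 : (0 : ℝ) < 1 + exo.ω k ^ 2 := by positivity
  have h1 : ‖exo.block k v‖ ≤ N * ((|exo.ω k| + 1) * ‖exo.proj k v‖) := by
    refine (exo.norm_block_le k v).trans (mul_le_mul_of_nonneg_right ?_ (by positivity))
    exact_mod_cast hN k
  have h2 := pow_le_pow_left₀ (norm_nonneg _) h1 2
  have h3 : (|exo.ω k| + 1) ^ 2 ≤ 4 * (1 + exo.ω k ^ 2) := by
    nlinarith [sq_nonneg (|exo.ω k| - 1), sq_abs (exo.ω k)]
  rw [Real.rpow_add h0, Real.rpow_one]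
  calc (1 + exo.ω k ^ 2) ^ α * ‖exo.block k v‖ ^ 2
      ≤ (1 + exo.ω k ^ 2) ^ α * (N * ((|exo.ω k| + 1) * ‖exo.proj k v‖)) ^ 2 := by gcongr
    _ = (1 + exo.ω k ^ 2) ^ α * (N ^ 2 * ((|exo.ω k| + 1) ^ 2 * ‖exo.proj k v‖ ^ 2)) := by ring
    _ ≤ (1 + exo.ω k ^ 2) ^ α *
        (N ^ 2 * ((4 * (1 + exo.ω k ^ 2)) * ‖exo.proj k v‖ ^ 2)) := by gcongr
    _ = _ := by ring

theorem S_basis (k : κ) (l : Fin (exo.n k)) (h : exo.φ ⟨k, l⟩ ∈ exo.S.domain) :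
    exo.S ⟨exo.φ ⟨k, l⟩, h⟩ = exo.freq k • exo.φ ⟨k, l⟩ +
      if 0 < (l : ℕ) then exo.φ ⟨k, ⟨(l : ℕ) - 1, lt_of_le_of_lt (Nat.sub_le _ _) l.2⟩⟩ else 0 := by
  rw [← block_basis]
  exact tsum_eq_single k fun j hj => exo.block_basis_of_ne hj l

end S

/-! ### The flow -/

/-- The `k`-th block of the flow. -/
noncomputable def blockFlow (t : ℝ) (k : κ) : W →L[ℂ] W :=
  ∑ l : Fin (exo.n k), (innerSL ℂ (exo.φ ⟨k, l⟩)).smulRight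
    (Complex.exp (exo.freq k * t) • ∑ j ∈ Finset.Iic l,
      ((t : ℂ) ^ ((l : ℕ) - (j : ℕ)) / (((l : ℕ) - (j : ℕ)).factorial : ℂ)) • exo.φ ⟨k, j⟩)

theorem blockFlow_apply (t : ℝ) (k : κ) (v : W) : exo.blockFlow t k v =
    ∑ l : Fin (exo.n k), inner ℂ (exo.φ ⟨k, l⟩) v • (Complex.exp (exo.freq k * t) •
      ∑ j ∈ Finset.Iic l, ((t : ℂ) ^ ((l : ℕ) - (j : ℕ)) / (((l : ℕ) - (j : ℕ)).factorial : ℂ)) •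
        exo.φ ⟨k, j⟩) := by
  simp [blockFlow]

theorem flow_eq_tsum (t : ℝ) (v : W) : exo.flow t v = ∑' k, exo.blockFlow t k v := by
  refine tsum_congr fun k => ?_
  rw [blockFlow_apply, Finset.smul_sum]
  exact Finset.sum_congr rfl fun l _ => smul_comm _ _ _

theorem proj_blockFlow (t : ℝ) (k : κ) (v : W) :
    exo.proj k (exo.blockFlow t k v) = exo.blockFlow t k v := by
  simp [blockFlow_apply, proj_basis]

/-- A bound for the norm of the flow. -/
noncomputable def growth (N : ℕ) (t : ℝ) : ℝ := N * (N * (1 + |t|) ^ N)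

theorem growth_nonneg (N : ℕ) (t : ℝ) : 0 ≤ growth N t := by
  unfold growth; positivity

theorem growth_mono (N : ℕ) {s t : ℝ} (hs : 0 ≤ s) (h : s ≤ t) : growth N s ≤ growth N t := by
  unfold growth
  rw [abs_of_nonneg hs, abs_of_nonneg (hs.trans h)]
  gcongr

theorem norm_exp_freq (k : κ) (t : ℝ) : ‖Complex.exp (exo.freq k * t)‖ = 1 := by
  rw [freq, mul_comm Complex.I, mul_right_comm, ← Complex.ofReal_mul,
    Complex.norm_exp_ofReal_mul_I]

-- Each of the two nested sums has at most N terms, the exponentials have modulus one, and |t|^m/m!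
-- ≤ (1 + |t|)^N for m ≤ N. Bounded block sizes make the estimate uniform in k.
variable {exo} in
theorem norm_blockFlow_le {N : ℕ} (hN : ∀ k, exo.n k ≤ N) (t : ℝ) (k : κ) (v : W) :
    ‖exo.blockFlow t k v‖ ≤ growth N t * ‖exo.proj k v‖ := by
  rw [blockFlow_apply]
  have hNk : (exo.n k : ℝ) ≤ N := by exact_mod_cast hN k
  have hterm : ∀ l : Fin (exo.n k), ∀ j : Fin (exo.n k),
      ‖((t : ℂ) ^ ((l : ℕ) - (j : ℕ)) / (((l : ℕ) - (j : ℕ)).factorial : ℂ)) • exo.φ ⟨k, j⟩‖ ≤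
        (1 + |t|) ^ N := by
    intro l j
    rw [norm_smul, norm_basis, mul_one, norm_div, norm_pow, Complex.norm_real, Real.norm_eq_abs,
      Complex.norm_natCast]
    refine (div_le_self (by positivity) (Nat.one_le_cast.mpr (Nat.factorial_pos _))).trans ?_
    refine (pow_le_pow_left₀ (abs_nonneg t) (by linarith : |t| ≤ 1 + |t|) _).trans ?_
    exact pow_le_pow_right₀ (by linarith [abs_nonneg t])
      ((Nat.sub_le _ _).trans (l.2.le.trans (hN k)))
  have hin : ∀ l : Fin (exo.n k), ‖∑ j ∈ Finset.Iic l,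
      ((t : ℂ) ^ ((l : ℕ) - (j : ℕ)) / (((l : ℕ) - (j : ℕ)).factorial : ℂ)) • exo.φ ⟨k, j⟩‖ ≤
        N * (1 + |t|) ^ N := by
    intro l
    refine (norm_sum_le_of_le _ fun j _ => hterm l j).trans ?_
    rw [Finset.sum_const, nsmul_eq_mul]
    gcongr
    exact_mod_cast (Finset.card_le_univ _).trans (by simpa using hN k)
  refine (norm_sum_le_of_le _ (n := fun _ => ‖exo.proj k v‖ * (N * (1 + |t|) ^ N))
    fun l _ => ?_).trans ?_
  · rw [norm_smul, norm_smul, norm_exp_freq, one_mul]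
    exact mul_le_mul (exo.norm_inner_le_norm_proj k l v) (hin l) (norm_nonneg _) (norm_nonneg _)
  · rw [Finset.sum_const, nsmul_eq_mul, growth, Finset.card_univ, Fintype.card_fin,
      mul_comm ‖exo.proj k v‖, ← mul_assoc]
    gcongr

/-- The functions `e^{iω_k t} t^m / m!`. -/
noncomputable def coef (k : κ) (m : ℕ) (t : ℝ) : ℂ :=
  Complex.exp (exo.freq k * t) * ((t : ℂ) ^ m / (m.factorial : ℂ))

theorem hasDerivAt_coef_zero (k : κ) (t : ℝ) :
    HasDerivAt (exo.coef k 0) (exo.freq k * exo.coef k 0 t) t := by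
  have h2 : HasDerivAt (fun s : ℝ => exo.freq k * (s : ℂ)) (exo.freq k) t := by
    simpa using (Complex.ofRealCLM.hasDerivAt (x := t)).const_mul (exo.freq k)
  have h3 : exo.coef k 0 = fun s : ℝ => Complex.exp (exo.freq k * s) := by
    ext s
    simp [coef]
  rw [h3]
  exact h2.cexp.congr_deriv (mul_comm _ _)

theorem hasDerivAt_coef_succ (k : κ) (m : ℕ) (t : ℝ) : HasDerivAt (exo.coef k (m + 1))
    (exo.freq k * exo.coef k (m + 1) t + exo.coef k m t) t := by
  have h2 : HasDerivAt (fun s : ℝ => exo.freq k * (s : ℂ)) (exo.freq k) t := by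
    simpa using (Complex.ofRealCLM.hasDerivAt (x := t)).const_mul (exo.freq k)
  have h4 : HasDerivAt (fun s : ℝ => (s : ℂ) ^ (m + 1) / ((m + 1).factorial : ℂ))
      ((t : ℂ) ^ m / (m.factorial : ℂ)) t := by
    have h5 := ((Complex.ofRealCLM.hasDerivAt (x := t)).pow (m + 1)).div_const
      ((m + 1).factorial : ℂ)
    refine h5.congr_deriv ?_
    have h6 : ((m : ℂ) + 1) ≠ 0 := by exact_mod_cast Nat.succ_ne_zero m
    have h7 : (m.factorial : ℂ) ≠ 0 := by exact_mod_cast Nat.factorial_ne_zero m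
    simp only [Nat.factorial_succ, Nat.cast_mul, Nat.cast_add, Nat.cast_one, Nat.add_sub_cancel,
      Complex.ofRealCLM_apply, Complex.ofReal_one, mul_one]
    field_simp
  refine (h2.cexp.mul h4).congr_deriv ?_
  simp only [coef]
  ring

theorem continuous_coef (k : κ) (m : ℕ) : Continuous (exo.coef k m) := by
  unfold coef
  fun_prop

section Flow

variable [CompleteSpace W]

/-- The blocks are orthogonal and square summable by the growth bound, so the `tsum` defining the
flow does not take its default value. -/
theorem hasSum_flow (t : ℝ) (v : W) : HasSum (fun k => exo.blockFlow t k v) (exo.flow t v) := by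
  obtain ⟨N, hN⟩ := exo.n_bdd
  rw [flow_eq_tsum]
  refine (summable_of_proj_eq (exo.proj_blockFlow t · v) ?_).hasSum
  refine Summable.of_nonneg_of_le (fun k => by positivity) (fun k => ?_)
    ((exo.hasSum_norm_sq_proj v).summable.mul_left (growth N t ^ 2))
  rw [← mul_pow]
  exact pow_le_pow_left₀ (norm_nonneg _) (norm_blockFlow_le hN t k v) 2

theorem proj_flow (t : ℝ) (v : W) (k : κ) : exo.proj k (exo.flow t v) = exo.blockFlow t k v :=
  proj_of_hasSum (exo.proj_blockFlow t · v) (exo.hasSum_flow t v) k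

variable {exo} in
theorem norm_proj_flow_le {N : ℕ} (hN : ∀ k, exo.n k ≤ N) (t : ℝ) (v : W) (k : κ) :
    ‖exo.proj k (exo.flow t v)‖ ≤ growth N t * ‖exo.proj k v‖ := by
  rw [proj_flow]
  exact norm_blockFlow_le hN t k v

variable {exo} in
theorem norm_flow_le {N : ℕ} (hN : ∀ k, exo.n k ≤ N) (t : ℝ) (v : W) :
    ‖exo.flow t v‖ ≤ growth N t * ‖v‖ := by
  refine (sq_le_sq₀ (norm_nonneg _) (mul_nonneg (growth_nonneg N t) (norm_nonneg v))).mp ?_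
  rw [mul_pow]
  refine hasSum_le (fun k => ?_) (exo.hasSum_norm_sq_proj (exo.flow t v))
    ((exo.hasSum_norm_sq_proj v).mul_left (growth N t ^ 2))
  rw [← mul_pow]
  exact pow_le_pow_left₀ (norm_nonneg _) (norm_proj_flow_le hN t v k) 2

/-- `T_S(t)` as a linear operator. -/
noncomputable def flowL (t : ℝ) : W →ₗ[ℂ] W where
  toFun := exo.flow t
  map_add' v w := ((exo.hasSum_flow t (v + w)).unique <| by
    simpa using (exo.hasSum_flow t v).add (exo.hasSum_flow t w))
  map_smul' c v := ((exo.hasSum_flow t (c • v)).unique <| by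
    simpa using (exo.hasSum_flow t v).const_smul c)

theorem flowL_apply (t : ℝ) (v : W) : exo.flowL t v = exo.flow t v := rfl

theorem flow_mem_Wsp {β : ℝ} (t : ℝ) {v : W} (hv : v ∈ exo.Wsp β) : exo.flow t v ∈ exo.Wsp β := by
  obtain ⟨N, hN⟩ := exo.n_bdd
  exact mem_Wsp_of_norm_proj_le (norm_proj_flow_le hN t v) hv

/-- The restriction of `T_S(t)` to `W_β`. -/
noncomputable def flowW (β t : ℝ) : exo.Wsp β →ₗ[ℂ] exo.Wsp β :=
  (exo.flowL t).restrict fun _ hv => exo.flow_mem_Wsp t hv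

theorem coe_flowW (β t : ℝ) (v : exo.Wsp β) : (exo.flowW β t v : W) = exo.flow t v := rfl

theorem flow_basis (t : ℝ) (k : κ) (l : Fin (exo.n k)) : exo.flow t (exo.φ ⟨k, l⟩) =
    ∑ j ∈ Finset.Iic l, exo.coef k ((l : ℕ) - (j : ℕ)) t • exo.φ ⟨k, j⟩ := by
  classical
  refine (exo.hasSum_flow t _).unique ?_
  have h1 : exo.blockFlow t k (exo.φ ⟨k, l⟩) =
      ∑ j ∈ Finset.Iic l, exo.coef k ((l : ℕ) - (j : ℕ)) t • exo.φ ⟨k, j⟩ := by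
    rw [blockFlow_apply, Finset.sum_eq_single l]
    · rw [inner_basis, if_pos rfl, one_smul, Finset.smul_sum]
      simp only [coef, smul_smul]
    · intro m _ hm
      rw [inner_basis, if_neg, zero_smul]
      intro h
      exact hm (by simpa using h)
    · simp
  rw [← h1]
  refine hasSum_single k fun j hj => ?_
  rw [blockFlow_apply]
  refine Finset.sum_eq_zero fun m _ => ?_
  rw [inner_basis, if_neg, zero_smul]
  intro h
  exact hj (congrArg Sigma.fst h)

/-- On the span of the basis the flow is a finite sum with continuous coefficients. The growth bound
is uniform on [0, t], so approximating v from this dense span approximates its orbit uniformly. -/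
theorem continuousOn_flow (t : ℝ) (v : W) :
    ContinuousOn (fun s => exo.flow s v) (Set.Icc 0 t) := by
  obtain ⟨N, hN⟩ := exo.n_bdd
  have hspan : ∀ w ∈ Submodule.span ℂ (Set.range exo.φ), Continuous fun s => exo.flow s w := by
    intro w hw
    induction hw using Submodule.span_induction with
    | mem w hw =>
      obtain ⟨⟨k, l⟩, rfl⟩ := hw
      simp only [flow_basis]
      exact continuous_finsetSum _ fun j _ => (exo.continuous_coef k _).smul continuous_const
    | zero =>
      simp only [← flowL_apply, map_zero]
      exact continuous_const
    | add a b _ _ ha hb =>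
      simp only [← flowL_apply, map_add] at ha hb ⊢
      exact ha.add hb
    | smul c a _ ha =>
      simp only [← flowL_apply, map_smul] at ha ⊢
      exact ha.const_smul c
  refine continuousOn_of_uniform_approx_of_continuousOn fun u hu => ?_
  obtain ⟨ε, hε, hεu⟩ := Metric.mem_uniformity_dist.mp hu
  have hg : 0 < growth N t + 1 := by linarith [growth_nonneg N t]
  have hv : v ∈ closure (Submodule.span ℂ (Set.range exo.φ) : Set W) := by
    rw [← Submodule.topologicalClosure_coe, exo.φ.dense_span]
    trivial
  obtain ⟨w, hw, hd⟩ := Metric.mem_closure_iff.mp hv (ε / (growth N t + 1)) (div_pos hε hg)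
  refine ⟨fun s => exo.flow s w, (hspan w hw).continuousOn, fun s hs => hεu ?_⟩
  have h1 : exo.flow s v - exo.flow s w = exo.flow s (v - w) := (map_sub (exo.flowL s) v w).symm
  rw [dist_eq_norm, h1]
  rw [dist_eq_norm, lt_div_iff₀ hg] at hd
  refine (norm_flow_le hN s _).trans_lt ((mul_le_mul_of_nonneg_right
    (growth_mono N hs.1 hs.2) (norm_nonneg _)).trans_lt ?_)
  nlinarith [norm_nonneg (v - w)]

end Flow

end Exosystem

/-! ### The flow along a Jordan chain as a solution of v' = Sv. -/

namespace Exosystem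

variable {κ W : Type*} [NormedAddCommGroup W] [InnerProductSpace ℂ W] (exo : Exosystem κ W)

/-- The vectors of the `k`-th Jordan chain in `W_β`, extended by zero. -/
noncomputable def seqW (β : ℝ) (k : κ) (j : ℕ) : exo.Wsp β :=
  if h : j < exo.n k then exo.basisW β ⟨k, ⟨j, h⟩⟩ else 0

theorem seqW_fin (β : ℝ) (k : κ) (l : Fin (exo.n k)) :
    exo.seqW β k l = exo.basisW β ⟨k, l⟩ := by
  rw [seqW, dif_pos l.2]

theorem coe_basisW (β : ℝ) (p : Σ k : κ, Fin (exo.n k)) : (exo.basisW β p : W) = exo.φ p := rfl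

theorem block_seqW_zero (β : ℝ) (k : κ) :
    exo.block k (exo.seqW β k 0) = exo.freq k • (exo.seqW β k 0 : W) := by
  have h := exo.block_basis k ⟨0, exo.n_pos k⟩
  rw [seqW, dif_pos (exo.n_pos k)]
  simpa [coe_basisW] using h

theorem block_seqW_succ (β : ℝ) (k : κ) {l : ℕ} (hl : l + 1 < exo.n k) :
    exo.block k (exo.seqW β k (l + 1)) =
      exo.freq k • (exo.seqW β k (l + 1) : W) + exo.seqW β k l := by
  have h := exo.block_basis k ⟨l + 1, hl⟩
  rw [seqW, seqW, dif_pos hl, dif_pos (by omega)]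
  simpa [coe_basisW] using h

theorem sum_Iic_fin {M : Type*} [AddCommMonoid M] {n : ℕ} (l : Fin n) (f : ℕ → M) :
    ∑ j ∈ Finset.Iic l, f j = ∑ j ∈ Finset.range (l + 1), f j := by
  have h := Finset.sum_map (Finset.Iic l) Fin.valEmbedding f
  rw [Fin.map_valEmbedding_Iic] at h
  refine h.symm.trans (Finset.sum_congr ?_ fun _ _ => rfl)
  ext j
  simp

variable [CompleteSpace W]

theorem S_eq_block {k : κ} (v : exo.S.domain) (h : ∀ j, j ≠ k → exo.block j (v : W) = 0) :
    exo.S v = exo.block k (v : W) :=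
  tsum_eq_single k h

theorem flowW_seqW (β t : ℝ) (k : κ) {l : ℕ} (hl : l < exo.n k) : exo.flowW β t (exo.seqW β k l) =
    ∑ j ∈ Finset.range (l + 1), exo.coef k (l - j) t • exo.seqW β k j := by
  have h1 := sum_Iic_fin (⟨l, hl⟩ : Fin (exo.n k)) fun j =>
    exo.coef k (l - j) t • exo.seqW β k j
  rw [← h1]
  refine Subtype.ext ?_
  rw [coe_flowW]
  simp only [seqW_fin, AddSubmonoidClass.coe_finsetSum, Submodule.coe_smul]
  rw [show exo.seqW β k l = exo.basisW β ⟨k, ⟨l, hl⟩⟩ from exo.seqW_fin β k ⟨l, hl⟩]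
  exact exo.flow_basis t k ⟨l, hl⟩

theorem S_flow_eq_block (t : ℝ) (k : κ) (l : Fin (exo.n k))
    (h : exo.flow t (exo.φ ⟨k, l⟩) ∈ exo.S.domain) :
    exo.S ⟨exo.flow t (exo.φ ⟨k, l⟩), h⟩ = exo.block k (exo.flow t (exo.φ ⟨k, l⟩)) := by
  refine exo.S_eq_block _ fun j hj => ?_
  simp only [flow_basis, map_sum, map_smul, exo.block_basis_of_ne hj, smul_zero,
    Finset.sum_const_zero]

/-- Along the basis vectors the flow solves `v' = S v` algebraically, i.e. in the image of every
linear map. -/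
theorem hasDerivAt_linear_flow {α : ℝ} (hα : 0 ≤ α) {E : Type*} [NormedAddCommGroup E]
    [NormedSpace ℂ E] (L : exo.Wsp α →ₗ[ℂ] E) (p : Σ k : κ, Fin (exo.n k)) (t : ℝ)
    (h : exo.flow t (exo.φ p) ∈ exo.Wsp (α + 1)) :
    HasDerivAt (fun s => L (exo.flowW α s (exo.basisW α p)))
      (L ⟨exo.S ⟨exo.flow t (exo.φ p), exo.Wsp_le_domain hα h⟩, exo.S_mem_Wsp hα h⟩) t := by
  obtain ⟨k, l, hl⟩ := p
  have hS := exo.S_flow_eq_block t k ⟨l, hl⟩ (exo.Wsp_le_domain hα h)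
  have hv := congrArg Subtype.val (exo.flowW_seqW α t k hl)
  have hb : exo.basisW α ⟨k, ⟨l, hl⟩⟩ = exo.seqW α k l := (exo.seqW_fin α k ⟨l, hl⟩).symm
  have hv' : exo.flow t (exo.φ ⟨k, ⟨l, hl⟩⟩) =
      ∑ j ∈ Finset.range (l + 1), exo.coef k (l - j) t • (exo.seqW α k j : W) := by
    rw [coe_flowW, ← hb] at hv
    simpa only [coe_basisW, AddSubmonoidClass.coe_finsetSum, Submodule.coe_smul] using hv
  -- The orbit stays in the span of one finite chain, so L passes through the sum without any
  -- continuity and only scalar coefficients are differentiated.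
  simp only [hb, exo.flowW_seqW α _ k hl, map_sum, map_smul]
  cases l with
  | zero =>
    have hd := (exo.hasDerivAt_coef_zero k t).smul_const (L (exo.seqW α k 0))
    simp only [zero_add, Finset.sum_range_one, Nat.sub_zero]
    refine hd.congr_deriv ?_
    rw [← map_smul]
    congr 1
    refine Subtype.ext ?_
    change _ = exo.S ⟨exo.flow t (exo.φ ⟨k, ⟨0, hl⟩⟩), _⟩
    rw [hS, hv']
    simp only [zero_add, Finset.sum_range_one, Nat.sub_zero, map_smul, block_seqW_zero,
      Submodule.coe_smul, smul_smul]
    rw [mul_comm]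
  | succ l =>
    -- The top term j = l + 1 is kept apart: its coefficient is a pure exponential, whose derivative
    -- has no lower-order part.
    have hd : HasDerivAt (fun s => ∑ j ∈ Finset.range (l + 1 + 1),
        exo.coef k (l + 1 - j) s • L (exo.seqW α k j))
        (∑ j ∈ Finset.range (l + 1), (exo.freq k * exo.coef k (l + 1 - j) t +
          exo.coef k (l - j) t) • L (exo.seqW α k j) +
          (exo.freq k * exo.coef k 0 t) • L (exo.seqW α k (l + 1))) t := by
      simp only [Finset.sum_range_succ _ (l + 1), Nat.sub_self]
      refine HasDerivAt.add (HasDerivAt.fun_sum fun j hj => ?_)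
        ((exo.hasDerivAt_coef_zero k t).smul_const _)
      have hj' : l + 1 - j = (l - j) + 1 := by
        have := Finset.mem_range.mp hj
        omega
      rw [hj']
      exact (exo.hasDerivAt_coef_succ k (l - j) t).smul_const _
    refine hd.congr_deriv ?_
    simp only [← map_smul, ← map_sum, ← map_add]
    congr 1
    refine Subtype.ext ?_
    change _ = exo.S ⟨exo.flow t (exo.φ ⟨k, ⟨l + 1, hl⟩⟩), _⟩
    -- Since S sends the chain vector j + 1 partly to the vector j, reindexing by one matches these
    -- contributions with the lower-order parts of the derivatives.
    have h1 : ∀ j ∈ Finset.range (l + 1),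
        exo.block k (exo.coef k (l + 1 - (j + 1)) t • (exo.seqW α k (j + 1) : W)) =
          (exo.freq k * exo.coef k (l + 1 - (j + 1)) t) • (exo.seqW α k (j + 1) : W) +
            exo.coef k (l - j) t • (exo.seqW α k j : W) := fun j hj => by
      rw [map_smul, exo.block_seqW_succ α k (by have := Finset.mem_range.mp hj; omega), smul_add,
        smul_smul, mul_comm, Nat.add_sub_add_right]
    have h2 := Finset.sum_range_succ' (fun j => (exo.freq k * exo.coef k (l + 1 - j) t) •
      (exo.seqW α k j : W)) (l + 1)
    rw [Finset.sum_range_succ, Nat.sub_self] at h2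
    rw [hS, hv', map_sum, Finset.sum_range_succ' _ (l + 1), Finset.sum_congr rfl h1, map_smul,
      block_seqW_zero, smul_smul, mul_comm _ (exo.freq k), Finset.sum_add_distrib, add_right_comm,
      ← h2]
    simp only [Submodule.coe_add, AddSubmonoidClass.coe_finsetSum, Submodule.coe_smul, add_smul,
      Finset.sum_add_distrib]
    exact add_right_comm _ _ _

end Exosystem

/-! ### Back substitution in block triangular systems. -/

section Shift

variable {E : Type*} [AddCommGroup E] {n : ℕ}

/-- The vector `(x₂, …, xₙ, 0)`. -/
def shift (x : Fin n → E) (i : Fin n) : E := if h : (i : ℕ) + 1 < n then x ⟨i + 1, h⟩ else 0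

theorem shift_sub (x y : Fin n → E) (i : Fin n) :
    shift (fun j => x j - y j) i = shift x i - shift y i := by
  unfold shift
  split_ifs <;> simp

theorem shift_mk {F : Type*} [AddCommGroup F] (x : Fin n → E) (y : Fin n → F) (i : Fin n) :
    shift (fun j => (x j, y j)) i = (shift x i, shift y i) := by
  unfold shift
  split_ifs <;> rfl

/-- Induct downwards from the last index, where the shift is zero by definition. All uniqueness
claims for the triangular systems reduce to this. -/
theorem eq_zero_of_shift {x : Fin n → E} (h : ∀ i, shift x i = 0 → x i = 0) (i : Fin n) :
    x i = 0 := by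
  have key : ∀ m : ℕ, ∀ i : Fin n, n - (i : ℕ) ≤ m → x i = 0 := by
    intro m
    induction m with
    | zero => intro i hi; have := i.2; omega
    | succ m ih =>
      intro i hi
      refine h i ?_
      unfold shift
      split_ifs with h1
      · refine ih _ ?_
        change n - ((i : ℕ) + 1) ≤ m
        omega
      · rfl
  exact key _ i le_rfl

end Shift

namespace Plant

variable {X U Y W Z κ : Type*}
  [NormedAddCommGroup X] [NormedSpace ℂ X] [NormedAddCommGroup U] [NormedSpace ℂ U]
  [NormedAddCommGroup Y] [NormedSpace ℂ Y] [NormedAddCommGroup Z] [NormedSpace ℂ Z]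
  [NormedAddCommGroup W] [InnerProductSpace ℂ W]

/-! ### The block resolvents -/

/-- Back substitution: apart from its diagonal entry, row i is -R(λ, A) applied to row i + 1, which
accounts for the alternating signs and the growing powers. -/
theorem blockResm1_eq (P : Plant X U Y W) (lam : ℂ) {n : ℕ} (y : Fin n → Xm1 P.A P.lam₀)
    (i : Fin n) : P.blockResm1 lam y i =
      resm1 P.A P.lam₀ lam (y i) - res P.A lam (shift (P.blockResm1 lam y) i) := by
  have h0 : P.blockResm1 lam y i = resm1 P.A P.lam₀ lam (y i) +
      ∑ j ∈ Finset.Ioi i, (-1 : ℂ) ^ ((j : ℕ) - (i : ℕ)) •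
        P.resPow lam ((j : ℕ) - (i : ℕ)) (y j) := by
    rw [blockResm1, ← Finset.Ioi_insert, Finset.sum_insert (by simp)]
    simp [resPow]
  rw [h0, sub_eq_add_neg]
  congr 1
  unfold shift
  split_ifs with h
  · have h1 : Finset.Ioi i = Finset.Ici ⟨(i : ℕ) + 1, h⟩ := by
      ext j
      rw [Finset.mem_Ioi, Finset.mem_Ici, Fin.lt_def, Fin.le_def]
      rfl
    rw [h1, blockResm1, map_sum, ← Finset.sum_neg_distrib]
    refine Finset.sum_congr rfl fun j hj => ?_
    rw [Finset.mem_Ici, Fin.le_def] at hj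
    change (i : ℕ) + 1 ≤ j at hj
    change _ = -(res P.A lam ((-1 : ℂ) ^ ((j : ℕ) - ((i : ℕ) + 1)) •
      P.resPow lam ((j : ℕ) - ((i : ℕ) + 1)) (y j)))
    obtain ⟨m, hm⟩ := Nat.exists_eq_add_of_le hj
    rw [hm, Nat.add_sub_cancel_left, show (i : ℕ) + 1 + m - i = m + 1 by omega, map_smul,
      pow_succ, mul_neg_one, neg_smul]
    congr 2
    simp only [resPow, pow_succ', ContinuousLinearMap.comp_apply]
    rfl
  · have h1 : Finset.Ioi i = ∅ := by
      ext j
      have := j.2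
      simp only [Finset.mem_Ioi, Fin.lt_def, Finset.notMem_empty, iff_false]
      omega
    rw [h1, Finset.sum_empty, map_zero, neg_zero]

theorem dense_domain [CompleteSpace X] (P : Plant X U Y W) : Dense (P.A.domain : Set X) := by
  obtain ⟨T, hT⟩ := P.generates
  exact hT.dense_domain

/-- Only the first resolvent applied acts on X₋₁, and on X it agrees with R(λ, A). The inputs BKz
and EΦ_k can then be treated as one input in X₋₁. -/
theorem blockRes_eq [CompleteSpace X] (P : Plant X U Y W) {lam : ℂ} (h : lam ∈ resSet P.A) {n : ℕ}
    (x : Fin n → X) (i : Fin n) :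
    P.blockRes lam x i = P.blockResm1 lam (fun j => embed P.A P.lam₀ (x j)) i := by
  refine Finset.sum_congr rfl fun j _ => ?_
  congr 1
  rw [resPow, ContinuousLinearMap.comp_apply, resm1_embed P.dense_domain P.lam₀_mem h, pow_succ]
  rfl

theorem blockResm1_add (P : Plant X U Y W) (lam : ℂ) {n : ℕ} (y y' : Fin n → Xm1 P.A P.lam₀)
    (i : Fin n) : P.blockResm1 lam (fun j => y j + y' j) i =
      P.blockResm1 lam y i + P.blockResm1 lam y' i := by
  simp only [blockResm1, map_add, smul_add, Finset.sum_add_distrib]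

/-- `x = ℝ(lam, A₋₁) y` is the unique solution of the block triangular system. -/
theorem blockResm1_iff [CompleteSpace X] (P : Plant X U Y W) {lam : ℂ} (h : lam ∈ resSet P.A)
    {n : ℕ} {x : Fin n → X} {y : Fin n → Xm1 P.A P.lam₀} :
    (∀ i, lam • embed P.A P.lam₀ (x i) - Am1 P.A P.lam₀ (x i) =
      y i - embed P.A P.lam₀ (shift x i)) ↔ x = P.blockResm1 lam y := by
  have h1 : ∀ i, lam • embed P.A P.lam₀ (x i) - Am1 P.A P.lam₀ (x i) =
      y i - embed P.A P.lam₀ (shift x i) ↔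
      x i = resm1 P.A P.lam₀ lam (y i) - res P.A lam (shift x i) := fun i => by
    rw [smul_embed_sub_Am1_eq_iff P.dense_domain P.lam₀_mem h, map_sub,
      resm1_embed P.dense_domain P.lam₀_mem h]
  simp only [h1]
  constructor
  · intro hx
    funext i
    -- The difference d of two solutions satisfies d_i = -R(λ, A)d_{i+1}.
    refine sub_eq_zero.mp (eq_zero_of_shift (x := fun i => x i - P.blockResm1 lam y i)
      (fun i hi => ?_) i)
    rw [shift_sub] at hi
    rw [hx i, P.blockResm1_eq lam y i, sub_sub_sub_cancel_left, ← map_sub, ← neg_sub, hi,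
      neg_zero, map_zero]
  · rintro rfl i
    exact P.blockResm1_eq lam y i

/-! ### The frequency equations and the Sylvester equation -/

section Frequency

variable (P : Plant X U Y W) (ctrl : Controller Y U Z) (exo : Exosystem κ W)

/-- The plant component of the solution of the block triangular system. -/
noncomputable def plantVec (k : κ) (z : Fin (exo.n k) → ctrl.G₁.domain) (i : Fin (exo.n k)) : X :=
  P.blockResm1 (exo.freq k) (fun j => P.B (ctrl.Kdom (z j))) i +
    P.blockRes (exo.freq k) (fun j => P.E (exo.Phi k j)) i

theorem plantVec_eq [CompleteSpace X] {k : κ} (h : exo.freq k ∈ resSet P.A)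
    (z : Fin (exo.n k) → ctrl.G₁.domain) : P.plantVec ctrl exo k z =
      P.blockResm1 (exo.freq k) fun j => P.B (ctrl.Kdom (z j)) +
        embed P.A P.lam₀ (P.E (exo.Phi k j)) := by
  funext i
  rw [blockResm1_add, plantVec, blockRes_eq P h]

theorem plantVec_mem {k : κ} (h : exo.freq k ∈ resSet P.A)
    (z : Fin (exo.n k) → ctrl.G₁.domain) (i : Fin (exo.n k)) :
    P.plantVec ctrl exo k z i ∈ P.C.domain :=
  P.C.domain.add_mem (P.blockResm1_mem h _ i) (P.blockRes_mem h _ i)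

theorem errorVec_eq {k : κ} (h : exo.freq k ∈ resSet P.A)
    (z : Fin (exo.n k) → ctrl.G₁.domain) (i : Fin (exo.n k)) :
    P.errorVec ctrl exo k h z i = P.C ⟨P.plantVec ctrl exo k z i, P.plantVec_mem ctrl exo h z i⟩ +
      P.D (ctrl.Kdom (z i)) + P.F (exo.Phi k i) := by
  have h1 := P.C.map_add ⟨_, P.blockResm1_mem h (fun j => ctrl.Kdom (z j)) i⟩
    ⟨_, P.blockRes_mem h (fun j => P.E (exo.Phi k j)) i⟩
  have h2 : P.C ⟨P.plantVec ctrl exo k z i, P.plantVec_mem ctrl exo h z i⟩ =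
    P.C ⟨_, P.blockResm1_mem h (fun j => ctrl.Kdom (z j)) i⟩ +
    P.C ⟨_, P.blockRes_mem h (fun j => P.E (exo.Phi k j)) i⟩ := h1
  rw [h2, errorVec, blockTransfer, blockCR]
  abel

/-- The vector `s` solves the Sylvester equation on the `k`-th Jordan chain. -/
def ChainSol (k : κ) (s : Fin (exo.n k) → X × Z) : Prop :=
  ∀ i, (s i, exo.freq k • s i + shift s i - P.Be ctrl (exo.Phi k i)) ∈ P.graphAe ctrl

variable {P ctrl exo}

/-- Block elimination. The X-row of the graph condition is a triangular system in X₋₁ with input BKz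
+ EΦ_k, whose only solution is the plant vector; inserting it into the Z-row leaves the frequency
equation. -/
theorem chainSol_iff [CompleteSpace X] {k : κ} (h : exo.freq k ∈ resSet P.A) {x : Fin (exo.n k) → X}
    {z : Fin (exo.n k) → ctrl.G₁.domain} :
    P.ChainSol ctrl exo k (fun i => (x i, (z i : Z))) ↔
      x = P.plantVec ctrl exo k z ∧ P.SolvesFreqEq ctrl exo k h z := by
  have hx1 : x = P.plantVec ctrl exo k z ↔ ∀ i, embed P.A P.lam₀ (exo.freq k • x i + shift x i -
      P.E (exo.Phi k i)) = Am1 P.A P.lam₀ (x i) + P.B (ctrl.Kdom (z i)) := by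
    rw [plantVec_eq P ctrl exo h, ← blockResm1_iff P h]
    refine forall_congr' fun i => ?_
    rw [map_sub, map_add, map_smul]
    constructor <;> intro h1
    · rw [sub_eq_iff_eq_add] at h1
      rw [h1]; abel
    · rw [sub_eq_iff_eq_add, ← eq_sub_iff_add_eq] at h1
      rw [h1]; abel
  have hJ : ∀ i, ctrl.JG (exo.freq k) z i =
      exo.freq k • (z i : Z) - ctrl.G₁ (z i) + shift (fun j => (z j : Z)) i := fun i => rfl
  constructor
  · intro hc
    have hx : x = P.plantVec ctrl exo k z := hx1.mpr fun i => by
      obtain ⟨_, _, h1, _⟩ := hc i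
      rw [shift_mk] at h1
      exact h1
    refine ⟨hx, fun i => ?_⟩
    subst hx
    obtain ⟨_, _, _, h2⟩ := hc i
    rw [shift_mk] at h2
    change exo.freq k • (z i : Z) + shift (fun j => (z j : Z)) i -
      ctrl.G₂ (P.F (exo.Phi k i)) = ctrl.G₂ (P.C ⟨P.plantVec ctrl exo k z i, _⟩) +
      (ctrl.G₁ (z i) + ctrl.G₂ (P.D (ctrl.Kdom (z i)))) at h2
    rw [hJ, errorVec_eq, map_add, map_add]
    rw [sub_eq_iff_eq_add] at h2
    rw [sub_add_eq_add_sub, h2]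
    abel
  · rintro ⟨hx, hz⟩ i
    refine ⟨?_, (z i).2, ?_, ?_⟩
    · rw [hx]
      exact P.plantVec_mem ctrl exo h z i
    · rw [shift_mk]
      exact hx1.mp hx i
    · subst hx
      rw [shift_mk]
      change exo.freq k • (z i : Z) + shift (fun j => (z j : Z)) i -
        ctrl.G₂ (P.F (exo.Phi k i)) = ctrl.G₂ (P.C ⟨P.plantVec ctrl exo k z i, _⟩) +
        (ctrl.G₁ (z i) + ctrl.G₂ (P.D (ctrl.Kdom (z i))))
      have h2 := hz i
      rw [hJ, errorVec_eq, map_add, map_add] at h2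
      rw [sub_add_eq_add_sub, sub_eq_iff_eq_add] at h2
      rw [h2]
      abel

/-- In the difference of two solutions the B_e terms cancel. Once the next entry vanishes, the
current one satisfies A_ed = iω_kd, which strong stability excludes unless d = 0. -/
theorem ChainSol.unique [CompleteSpace X] [CompleteSpace Z]
    (hs : ∃ T, Generates (P.Ae ctrl) T ∧ StronglyStable T) {k : κ}
    {s s' : Fin (exo.n k) → X × Z} (h : P.ChainSol ctrl exo k s) (h' : P.ChainSol ctrl exo k s') :
    s = s' := by
  obtain ⟨T, hT, hTs⟩ := hs
  funext i
  refine sub_eq_zero.mp (eq_zero_of_shift (x := fun i => s i - s' i) (fun i hi => ?_) i)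
  rw [shift_sub] at hi
  refine hT.eq_zero_of_stable hTs (w := exo.ω k) ?_
  rw [graph_Ae]
  have h1 := (P.graphAe ctrl).sub_mem (h i) (h' i)
  have h2 : exo.freq k • s i + shift s i - P.Be ctrl (exo.Phi k i) -
      (exo.freq k • s' i + shift s' i - P.Be ctrl (exo.Phi k i)) =
      exo.freq k • (s i - s' i) := by
    rw [sub_sub_sub_cancel_right, add_sub_add_comm, hi, add_zero, smul_sub]
  rw [Prod.mk_sub_mk, h2] at h1
  exact h1

end Frequency

/-! ### The Sylvester equation on a Jordan chain. -/

section Sylvester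

variable [CompleteSpace W] {P : Plant X U Y W} {ctrl : Controller Y U Z} {exo : Exosystem κ W}
  {α : ℝ} {hα : 0 ≤ α} {Sig : exo.Wsp α →ₗ[ℂ] (X × Z)}

namespace SolvesSylvester

/-- Here Sφ^l = iω_kφ^l + φ^{l-1}. The chain is listed from the top, as in Φ_k, so φ^{l-1} is the
next entry and the nilpotent part of S becomes `shift`. -/
theorem chainSol (hS : P.SolvesSylvester ctrl exo hα Sig) (k : κ) :
    P.ChainSol ctrl exo k fun i => Sig (exo.basisW α ⟨k, i.rev⟩) := by
  intro i
  have hm := exo.basis_mem_Wsp (α + 1) ⟨k, i.rev⟩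
  have h1 := hS.eqn _ hm
  have h2 := (P.Ae ctrl).mem_graph ⟨_, hS.mem_domain _ hm⟩
  rw [graph_Ae] at h2
  have key : exo.freq k • Sig (exo.basisW α ⟨k, i.rev⟩) +
      shift (fun i => Sig (exo.basisW α ⟨k, i.rev⟩)) i =
        Sig ⟨exo.S ⟨exo.φ ⟨k, i.rev⟩, exo.Wsp_le_domain hα hm⟩, exo.S_mem_Wsp hα hm⟩ := by
    have h3 := exo.S_basis k i.rev (exo.Wsp_le_domain hα hm)
    unfold shift
    split_ifs with h
    · rw [← map_smul, ← map_add]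
      congr 1
      refine Subtype.ext ?_
      have hi : 0 < (i.rev : ℕ) := by rw [Fin.val_rev]; omega
      rw [if_pos hi] at h3
      refine Eq.trans ?_ h3.symm
      change exo.freq k • exo.φ ⟨k, i.rev⟩ + exo.φ ⟨k, _⟩ = _
      congr 4
    · rw [add_zero, ← map_smul]
      congr 1
      refine Subtype.ext ?_
      have hi : ¬ 0 < (i.rev : ℕ) := by rw [Fin.val_rev]; omega
      rw [if_neg hi, add_zero] at h3
      exact h3.symm
  rw [← sub_eq_iff_eq_add.mpr h1, ← key] at h2
  exact h2

end SolvesSylvester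

end Sylvester

end Plant

namespace Plant

variable {X U Y W Z κ : Type*}
  [NormedAddCommGroup X] [NormedSpace ℂ X] [CompleteSpace X]
  [NormedAddCommGroup U] [NormedSpace ℂ U]
  [NormedAddCommGroup Y] [NormedSpace ℂ Y]
  [NormedAddCommGroup Z] [NormedSpace ℂ Z] [CompleteSpace Z]
  [NormedAddCommGroup W] [InnerProductSpace ℂ W] [CompleteSpace W]
  {P : Plant X U Y W} {ctrl : Controller Y U Z} {exo : Exosystem κ W}
  {α : ℝ} {hα : 0 ≤ α} {Sig : exo.Wsp α →ₗ[ℂ] (X × Z)} {T : ℝ → (X × Z) →L[ℂ] (X × Z)}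

-- The constants supplied by boundedness hypotheses carry no sign; absolute values let the estimates
-- be multiplied.
omit [CompleteSpace W] in
theorem norm_le_of_bound {β : ℝ} {E : Type*} [NormedAddCommGroup E] {M : ℝ} {v : W} {e : E}
    (h : ‖e‖ ≤ M * exo.normW β v) : ‖e‖ ≤ |M| * exo.normW β v :=
  h.trans (mul_le_mul_of_nonneg_right (le_abs_self M) (exo.normW_nonneg β v))

/-! ### The state of the closed-loop system -/

theorem continuousOn_forcing (hT : IsC0Semigroup T) (t : ℝ) (v : W) :
    ContinuousOn (fun s => T (t - s) (P.Be ctrl (exo.flow s v))) (Set.Icc 0 t) :=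
  hT.continuousOn_sub_apply ((P.Be ctrl).continuous.comp_continuousOn (exo.continuousOn_flow t v))

theorem intervalIntegrable_forcing (hT : IsC0Semigroup T) {t : ℝ} (ht : 0 ≤ t) (v : W) :
    IntervalIntegrable (fun s => T (t - s) (P.Be ctrl (exo.flow s v))) MeasureTheory.volume 0 t := by
  refine ContinuousOn.intervalIntegrable ?_
  rw [Set.uIcc_of_le ht]
  exact continuousOn_forcing hT t v

variable (P ctrl exo) in
/-- The forced response of the closed-loop system, as a linear function of the initial state of the
exosystem. -/
noncomputable def forced (hT : IsC0Semigroup T) {t : ℝ} (ht : 0 ≤ t) : W →ₗ[ℂ] (X × Z) where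
  toFun v := ∫ s in (0 : ℝ)..t, T (t - s) (P.Be ctrl (exo.flow s v))
  map_add' v w := by
    rw [← intervalIntegral.integral_add (intervalIntegrable_forcing hT ht v)
      (intervalIntegrable_forcing hT ht w)]
    simp only [← Exosystem.flowL_apply, map_add]
  map_smul' c v := by
    rw [RingHom.id_apply, ← intervalIntegral.integral_smul]
    simp only [← Exosystem.flowL_apply, map_smul]

omit [CompleteSpace X] [CompleteSpace Z] in
theorem exists_forcing_bound [CompleteSpace (X × Z)] (hT : IsC0Semigroup T) {t : ℝ} (ht : 0 ≤ t) :
    ∃ c : ℝ, ∀ v : W, ‖∫ s in (0 : ℝ)..t, T (t - s) (P.Be ctrl (exo.flow s v))‖ ≤ c * ‖v‖ := by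
  obtain ⟨N, hN⟩ := exo.n_bdd
  obtain ⟨M, hM, hb⟩ := hT.exists_bound t
  refine ⟨M * (‖P.Be ctrl‖ * Exosystem.growth N t) * |t - 0|, fun v => ?_⟩
  have h1 : ∀ s ∈ Set.uIoc 0 t, ‖T (t - s) (P.Be ctrl (exo.flow s v))‖ ≤
      M * (‖P.Be ctrl‖ * (Exosystem.growth N t * ‖v‖)) := by
    intro s hs
    rw [Set.uIoc_of_le ht] at hs
    refine (T (t - s)).le_of_opNorm_le_of_le (hb _ ⟨by linarith [hs.2], by linarith [hs.1]⟩) ?_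
    refine (P.Be ctrl).le_of_opNorm_le_of_le le_rfl ?_
    exact (Exosystem.norm_flow_le hN s v).trans (mul_le_mul_of_nonneg_right
      (Exosystem.growth_mono N hs.1.le hs.2) (norm_nonneg v))
  refine (intervalIntegral.norm_integral_le_of_norm_le_const h1).trans (le_of_eq ?_)
  ring

namespace SolvesSylvester

/-- Along the basis, the forced response is `Sig T_S(t) v - T(t) Sig v`. -/
theorem forced_basis (hS : P.SolvesSylvester ctrl exo hα Sig) (hT : Generates (P.Ae ctrl) T)
    {t : ℝ} (ht : 0 ≤ t) (p : Σ k : κ, Fin (exo.n k)) :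
    ∫ s in (0 : ℝ)..t, T (t - s) (P.Be ctrl (exo.flow s (exo.φ p))) =
      Sig (exo.flowW α t (exo.basisW α p)) - T t (Sig (exo.flowW α 0 (exo.basisW α p))) := by
  have hm : ∀ s, exo.flow s (exo.φ p) ∈ exo.Wsp (α + 1) := fun s =>
    exo.flow_mem_Wsp s (exo.basis_mem_Wsp _ p)
  have hd := fun s => exo.hasDerivAt_linear_flow hα Sig p s (hm s)
  -- For u(s) = ΣT_S(s)φ the Sylvester equation reads u' - A_eu = B_eT_S(s)φ, so Duhamel's formula
  -- produces exactly the forcing integral.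
  have he : ∀ s, Sig ⟨exo.S ⟨exo.flow s (exo.φ p), exo.Wsp_le_domain hα (hm s)⟩,
      exo.S_mem_Wsp hα (hm s)⟩ - P.Ae ctrl ⟨_, hS.mem_domain _ (hm s)⟩ =
      P.Be ctrl (exo.flow s (exo.φ p)) := fun s =>
    sub_eq_iff_eq_add'.mpr (hS.eqn _ (hm s))
  have h1 := hT.integral_sub_apply ht
    (u := fun s => Sig (exo.flowW α s (exo.basisW α p)))
    (u' := fun s => Sig ⟨exo.S ⟨exo.flow s (exo.φ p), exo.Wsp_le_domain hα (hm s)⟩,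
      exo.S_mem_Wsp hα (hm s)⟩)
    (y := fun s => P.Ae ctrl ⟨_, hS.mem_domain _ (hm s)⟩)
    (fun s _ => (hd s).continuousAt.continuousWithinAt)
    (fun s _ => (hd s).hasDerivWithinAt)
    (fun s _ => (P.Ae ctrl).mem_graph ⟨_, hS.mem_domain _ (hm s)⟩)
    (by
      simp only [he]
      exact (P.Be ctrl).continuous.comp_continuousOn (exo.continuousOn_flow t _))
  simp only [he] at h1
  exact h1

theorem flowW_zero (p : Σ k : κ, Fin (exo.n k)) :
    exo.flowW α 0 (exo.basisW α p) = exo.basisW α p := by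
  obtain ⟨k, l⟩ := p
  refine Subtype.ext ?_
  rw [Exosystem.coe_flowW, Exosystem.coe_basisW, Exosystem.flow_basis, Finset.sum_eq_single l]
  · simp [Exosystem.coef]
  · intro j hj hjl
    have h1 : (l : ℕ) - (j : ℕ) ≠ 0 := by
      have h2 := Fin.le_def.mp (Finset.mem_Iic.mp hj)
      have h3 := fun h => hjl (Fin.ext h)
      omega
    simp [Exosystem.coef, h1]
  · simp

/-- `x_e(t) = T(t)(x₀ - Sig v₀) + Sig T_S(t) v₀`. -/
theorem state_eq (hS : P.SolvesSylvester ctrl exo hα Sig) (hT : Generates (P.Ae ctrl) T)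
    {t : ℝ} (ht : 0 ≤ t) (x₀ : X × Z) (v : exo.Wsp α) :
    P.state ctrl exo T x₀ v t = T t (x₀ - Sig v) + Sig (exo.flowW α t v) := by
  -- L is the defect in the formula for the forced response. It is bounded on W_α and vanishes on
  -- the basis, so no differentiability of ΣT_S(t)v is needed for general v.
  let L : exo.Wsp α →ₗ[ℂ] (X × Z) :=
    (P.forced ctrl exo hT.semigroup ht).comp (exo.Wsp α).subtype -
      (Sig.comp (exo.flowW α t) - (T t).toLinearMap.comp Sig)
  have hL : ∀ v : exo.Wsp α, L v = (∫ s in (0 : ℝ)..t, T (t - s) (P.Be ctrl (exo.flow s v))) -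
      (Sig (exo.flowW α t v) - T t (Sig v)) := fun v => rfl
  have h0 : L = 0 := by
    refine Exosystem.eq_zero_of_basis ?_ fun p => ?_
    · obtain ⟨N, hN⟩ := exo.n_bdd
      obtain ⟨c, hc⟩ := exists_forcing_bound (P := P) (ctrl := ctrl) (exo := exo) hT.semigroup ht
      obtain ⟨M, hM⟩ := hS.bdd
      refine ⟨|c| + (|M| * Exosystem.growth N t + ‖T t‖ * |M|), fun v => ?_⟩
      rw [hL]
      have hn := exo.norm_le_normW hα v.2
      refine (norm_sub_le _ _).trans ?_
      rw [add_mul]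
      refine add_le_add ?_ ((norm_sub_le _ _).trans ?_)
      · refine (hc v).trans ((mul_le_mul_of_nonneg_right (le_abs_self c) (norm_nonneg _)).trans ?_)
        exact mul_le_mul_of_nonneg_left hn (abs_nonneg c)
      · rw [add_mul]
        refine add_le_add ?_ ?_
        · refine (norm_le_of_bound (hM _)).trans ?_
          rw [mul_assoc]
          refine mul_le_mul_of_nonneg_left ?_ (abs_nonneg M)
          exact Exosystem.normW_le_of_norm_proj_le (Exosystem.growth_nonneg N t)
            (Exosystem.norm_proj_flow_le hN t v) v.2
        · rw [mul_assoc]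
          exact (T t).le_of_opNorm_le_of_le le_rfl (norm_le_of_bound (hM v))
    · have h1 := hS.forced_basis hT ht p
      rw [flowW_zero] at h1
      rw [hL]
      exact sub_eq_zero.mpr h1
  have h1 : L v = 0 := by rw [h0]; rfl
  rw [hL, sub_eq_zero] at h1
  rw [state, h1, map_sub]
  abel

end SolvesSylvester

/-! ### The regulation error -/

namespace InClassO

variable (hP : P.InClassO ctrl exo hα)

/-- The operator `C_e` on `Dom(A_e)`. -/
noncomputable def CeDom : (P.Ae ctrl).domain →ₗ[ℂ] Y :=
  (P.Ce ctrl).toFun.comp (Submodule.inclusion hP.dom_le)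

omit [CompleteSpace X] [CompleteSpace Z] in
theorem exists_CeDom_bound : ∃ a b : ℝ, ∀ x : (P.Ae ctrl).domain,
    ‖hP.CeDom x‖ ≤ a * ‖P.Ae ctrl x‖ + b * ‖(x : X × Z)‖ := hP.rel_bdd

/-- The operator `C_e Sig + F` on `W_{α+1}`. -/
noncomputable def errorOp (hS : P.SolvesSylvester ctrl exo hα Sig) : exo.Wsp (α + 1) →ₗ[ℂ] Y :=
  hP.CeDom.comp ((Sig.comp (Submodule.inclusion (exo.Wsp_succ_le α))).codRestrict _
    fun v => hS.mem_domain v v.2) + P.F.toLinearMap.comp (exo.Wsp (α + 1)).subtype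

omit [CompleteSpace X] [CompleteSpace Z] in
theorem errorOp_apply (hS : P.SolvesSylvester ctrl exo hα Sig) (v : exo.Wsp (α + 1)) :
    hP.errorOp hS v = hP.CeDom ⟨Sig ⟨v, exo.Wsp_succ_le α v.2⟩, hS.mem_domain v v.2⟩ +
      P.F (v : W) := rfl

-- Relative boundedness of C_e reduces this to a bound for A_eΣ = ΣS - B_e, and S is bounded from
-- W_{α+1} to W_α. With this bound the basis determines the error operator.
omit [CompleteSpace X] [CompleteSpace Z] in
theorem exists_errorOp_bound (hS : P.SolvesSylvester ctrl exo hα Sig) :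
    ∃ M : ℝ, ∀ v, ‖hP.errorOp hS v‖ ≤ M * exo.normW (α + 1) v := by
  obtain ⟨a, b, hab⟩ := hP.exists_CeDom_bound
  obtain ⟨M, hM⟩ := hS.bdd
  obtain ⟨c, hc⟩ := exo.exists_normW_S_le hα
  refine ⟨|a| * (|M| * |c| + ‖P.Be ctrl‖) + |b| * |M| + ‖P.F‖, fun v => ?_⟩
  have hn : ‖(v : W)‖ ≤ exo.normW (α + 1) v := exo.norm_le_normW (by linarith) v.2
  have h1 : ‖Sig ⟨v, exo.Wsp_succ_le α v.2⟩‖ ≤ |M| * exo.normW (α + 1) v :=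
    (norm_le_of_bound (hM _)).trans
      (mul_le_mul_of_nonneg_left (exo.normW_mono v.2) (abs_nonneg M))
  have h2 : ‖P.Ae ctrl ⟨_, hS.mem_domain v v.2⟩‖ ≤
      (|M| * |c| + ‖P.Be ctrl‖) * exo.normW (α + 1) v := by
    rw [← sub_eq_iff_eq_add.mpr (hS.eqn v v.2), add_mul, mul_assoc]
    refine (norm_sub_le _ _).trans (add_le_add ?_ ((P.Be ctrl).le_of_opNorm_le_of_le le_rfl hn))
    refine (norm_le_of_bound (hM _)).trans (mul_le_mul_of_nonneg_left ?_ (abs_nonneg M))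
    exact (hc v v.2).trans
      (mul_le_mul_of_nonneg_right (le_abs_self c) (exo.normW_nonneg _ _))
  rw [errorOp_apply]
  refine (norm_add_le _ _).trans ?_
  rw [add_mul, add_mul, mul_assoc, mul_assoc]
  refine add_le_add ((hab _).trans (add_le_add ?_ ?_)) (P.F.le_of_opNorm_le_of_le le_rfl hn)
  · exact (mul_le_mul_of_nonneg_right (le_abs_self a) (norm_nonneg _)).trans
      (mul_le_mul_of_nonneg_left h2 (abs_nonneg a))
  · exact (mul_le_mul_of_nonneg_right (le_abs_self b) (norm_nonneg _)).trans
      (mul_le_mul_of_nonneg_left h1 (abs_nonneg b))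

/-- The regulation error is `C_e T(t)(x₀ - Sig v₀) + (C_e Sig + F) T_S(t) v₀`. -/
theorem error_eq (hS : P.SolvesSylvester ctrl exo hα Sig) (hT : Generates (P.Ae ctrl) T)
    {t : ℝ} (ht : 0 ≤ t) {x₀ : X × Z} (hx₀ : x₀ ∈ (P.Ae ctrl).domain) (v : exo.Wsp (α + 1)) :
    ∃ h : P.state ctrl exo T x₀ v t ∈ (P.Ce ctrl).domain,
      P.Ce ctrl ⟨P.state ctrl exo T x₀ v t, h⟩ + P.F (exo.flow t v) =
        hP.CeDom ⟨_, hT.apply_mem_domain ht ⟨x₀ - Sig ⟨v, exo.Wsp_succ_le α v.2⟩,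
          (P.Ae ctrl).domain.sub_mem hx₀ (hS.mem_domain v v.2)⟩⟩ +
        hP.errorOp hS (exo.flowW (α + 1) t v) := by
  set y : (P.Ae ctrl).domain := ⟨x₀ - Sig ⟨v, exo.Wsp_succ_le α v.2⟩,
          (P.Ae ctrl).domain.sub_mem hx₀ (hS.mem_domain v v.2)⟩ with hy
  have hm := exo.flow_mem_Wsp t v.2
  set a : (P.Ae ctrl).domain := ⟨_, hT.apply_mem_domain ht y⟩ with ha
  set b : (P.Ae ctrl).domain := ⟨_, hS.mem_domain _ hm⟩ with hb
  have h1 : P.state ctrl exo T x₀ v t = ((a + b : (P.Ae ctrl).domain) : X × Z) :=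
    hS.state_eq hT ht x₀ ⟨v, exo.Wsp_succ_le α v.2⟩
  have h2 : P.state ctrl exo T x₀ v t ∈ (P.Ae ctrl).domain := by
    rw [h1]; exact (a + b).2
  refine ⟨hP.dom_le h2, ?_⟩
  have h3 : P.Ce ctrl ⟨P.state ctrl exo T x₀ v t, hP.dom_le h2⟩ = hP.CeDom (a + b) := by
    rw [← show (⟨_, h2⟩ : (P.Ae ctrl).domain) = a + b from Subtype.ext h1]
    rfl
  rw [h3, map_add, errorOp_apply, add_assoc]
  rfl

/-- C_e may be unbounded, but on Dom(A_e) both T(t)x and A_eT(t)x = T(t)A_ex tend to zero, which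
suffices by relative boundedness. -/
theorem tendsto_CeDom_apply (hT : Generates (P.Ae ctrl) T) (x : (P.Ae ctrl).domain) {e : ℝ → Y}
    (he : ∀ t (ht : 0 ≤ t), e t = hP.CeDom ⟨_, hT.apply_mem_domain ht x⟩) :
    Tendsto e atTop (𝓝 0) := by
  obtain ⟨a, b, hab⟩ := hP.exists_CeDom_bound
  obtain ⟨T', hT', hs⟩ := hP.stable
  have h1 : Tendsto (fun t => a * ‖T' t (P.Ae ctrl x)‖ + b * ‖T' t (x : X × Z)‖) atTop (𝓝 0) := by
    simpa using ((hs (P.Ae ctrl x)).norm.const_mul a).add ((hs x).norm.const_mul b)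
  refine squeeze_zero_norm' ?_ h1
  filter_upwards [eventually_ge_atTop 0] with t ht
  -- Stability is known for some semigroup generated by A_e; uniqueness transfers it to the given
  -- one.
  rw [he t ht, ← hT.apply_unique hT' ht, ← hT.map_apply ht]
  exact hab _

-- Induct up the chain. If the operator vanishes on the lower vectors, its value along the flow of
-- φ^l is e^{iω_kt} times its value at φ^l, of constant norm.
omit [CompleteSpace X] [CompleteSpace Z] in
theorem errorOp_eq_zero_of_tendsto (hS : P.SolvesSylvester ctrl exo hα Sig)
    (h : ∀ v : exo.Wsp (α + 1),
      Tendsto (fun t => hP.errorOp hS (exo.flowW (α + 1) t v)) atTop (𝓝 0)) :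
    hP.errorOp hS = 0 := by
  have key : ∀ (k : κ) (l : ℕ), l < exo.n k → hP.errorOp hS (exo.seqW (α + 1) k l) = 0 := by
    intro k l
    induction l using Nat.strong_induction_on with
    | _ l ih =>
      intro hl
      have h1 := (h (exo.seqW (α + 1) k l)).norm
      rw [norm_zero] at h1
      refine norm_eq_zero.mp (tendsto_nhds_unique tendsto_const_nhds (h1.congr fun t => ?_))
      rw [exo.flowW_seqW _ _ _ hl, map_sum, Finset.sum_range_succ, Finset.sum_eq_zero, zero_add,
        map_smul, norm_smul, Nat.sub_self]
      · simp [Exosystem.coef, exo.norm_exp_freq]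
      · intro j hj
        have hj' := Finset.mem_range.mp hj
        rw [map_smul, ih j hj' (hj'.trans hl), smul_zero]
  refine Exosystem.eq_zero_of_basis (hP.exists_errorOp_bound hS) fun p => ?_
  rw [← exo.seqW_fin]
  exact key p.1 p.2 p.2.2

theorem robust_iff (hS : P.SolvesSylvester ctrl exo hα Sig) :
    P.Robust ctrl exo α ↔ hP.errorOp hS = 0 := by
  constructor
  · intro hR
    obtain ⟨T, hT, _⟩ := hP.stable
    refine hP.errorOp_eq_zero_of_tendsto hS fun v => ?_
    -- The initial state x₀ = Σv removes the transient, leaving only (C_eΣ + F)T_S(t)v.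
    obtain ⟨e, he, hlim⟩ := hR T hT _ (hS.mem_domain v v.2) v v.2
    refine hlim.congr' ?_
    filter_upwards [eventually_ge_atTop 0] with t ht
    obtain ⟨_, h1⟩ := he t ht
    obtain ⟨_, h2⟩ := hP.error_eq hS hT ht (hS.mem_domain v v.2) v
    rw [h1, h2, add_eq_right]
    convert map_zero hP.CeDom
    simp
  · intro h0 T hT x₀ hx₀ v₀ hv₀
    classical
    -- For t ≥ 0 the state always lies in Dom(C_e), so the default value can only occur at
    -- irrelevant negative times.
    refine ⟨fun t => if h : P.state ctrl exo T x₀ v₀ t ∈ (P.Ce ctrl).domain then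
      P.Ce ctrl ⟨P.state ctrl exo T x₀ v₀ t, h⟩ + P.F (exo.flow t v₀) else 0, ?_, ?_⟩
    · intro t ht
      obtain ⟨h, _⟩ := hP.error_eq hS hT ht hx₀ ⟨v₀, hv₀⟩
      exact ⟨h, dif_pos h⟩
    · refine hP.tendsto_CeDom_apply hT ⟨x₀ - Sig ⟨v₀, exo.Wsp_succ_le α hv₀⟩,
        (P.Ae ctrl).domain.sub_mem hx₀ (hS.mem_domain v₀ hv₀)⟩ fun t ht => ?_
      obtain ⟨h, h1⟩ := hP.error_eq hS hT ht hx₀ ⟨v₀, hv₀⟩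
      rw [h0, LinearMap.zero_apply, add_zero] at h1
      exact (dif_pos h).trans h1

/-- A solution of the frequency equation is the controller part of `Sig Φ_k`. -/
theorem eq_of_solvesFreqEq (hS : P.SolvesSylvester ctrl exo hα Sig) {k : κ}
    {z : Fin (exo.n k) → ctrl.G₁.domain} (hz : P.SolvesFreqEq ctrl exo k (hP.freq_mem k) z)
    (i : Fin (exo.n k)) :
    (P.plantVec ctrl exo k z i, (z i : Z)) = Sig (exo.basisW α ⟨k, i.rev⟩) :=
  congrFun (((chainSol_iff (hP.freq_mem k)).mpr ⟨rfl, hz⟩).unique hP.stable (hS.chainSol k)) i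

/-- The error vector is C_e applied to the pair of plant vector and z, plus FΦ_k, and this pair is
ΣΦ_k. It links the frequency-domain condition to C_eΣ + F = 0. -/
theorem errorVec_eq_errorOp (hS : P.SolvesSylvester ctrl exo hα Sig) {k : κ}
    {z : Fin (exo.n k) → ctrl.G₁.domain} (hz : P.SolvesFreqEq ctrl exo k (hP.freq_mem k) z)
    (i : Fin (exo.n k)) : P.errorVec ctrl exo k (hP.freq_mem k) z i =
      hP.errorOp hS (exo.basisW (α + 1) ⟨k, i.rev⟩) := by
  rw [errorVec_eq, errorOp_apply]
  congr 1
  have h1 := hP.eq_of_solvesFreqEq hS hz i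
  have h2 : (P.plantVec ctrl exo k z i, (z i : Z)) ∈ (P.Ae ctrl).domain := by
    rw [h1]; exact hS.mem_domain _ (exo.basis_mem_Wsp (α + 1) ⟨k, i.rev⟩)
  refine Eq.trans (b := hP.CeDom ⟨_, h2⟩) rfl ?_
  congr 1
  exact Subtype.ext h1

theorem existsUnique_solvesFreqEq (k : κ) : ∃! z : Fin (exo.n k) → ctrl.G₁.domain,
    P.SolvesFreqEq ctrl exo k (hP.freq_mem k) z := by
  obtain ⟨Sig, hS⟩ := hP.sylvester
  have hc := hS.chainSol k
  -- Existence: take the Z-component of ΣΦ_k; the graph condition places it in Dom(G₁).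
  let z : Fin (exo.n k) → ctrl.G₁.domain := fun i =>
    ⟨(Sig (exo.basisW α ⟨k, i.rev⟩)).2, (hc i).choose_spec.choose⟩
  refine ⟨z, ((chainSol_iff (hP.freq_mem k)
    (x := fun i => (Sig (exo.basisW α ⟨k, i.rev⟩)).1) (z := z)).mp hc).2, fun z' hz' => ?_⟩
  funext i
  exact Subtype.ext (congrArg Prod.snd (hP.eq_of_solvesFreqEq hS hz' i))

end InClassO

end Plant

end OutputReg

theorem mainTheorem8 {X U Y Z W κ : Type*}
    [NormedAddCommGroup X] [NormedSpace ℂ X] [CompleteSpace X]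
    [NormedAddCommGroup U] [NormedSpace ℂ U] [CompleteSpace U]
    [NormedAddCommGroup Y] [NormedSpace ℂ Y] [CompleteSpace Y]
    [NormedAddCommGroup Z] [NormedSpace ℂ Z] [CompleteSpace Z]
    [NormedAddCommGroup W] [InnerProductSpace ℂ W] [CompleteSpace W]
    (exo : OutputReg.Exosystem κ W) (ctrl : OutputReg.Controller Y U Z) (α : ℝ) (hα : 0 ≤ α)
    (P : OutputReg.Plant X U Y W) (hP : P.InClassO ctrl exo hα) :
    (∀ k, ∃! z : Fin (exo.n k) → ctrl.G₁.domain,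
      P.SolvesFreqEq ctrl exo k (hP.freq_mem k) z) ∧
    (P.Robust ctrl exo α ↔
      ∀ k, ∀ z : Fin (exo.n k) → ctrl.G₁.domain,
        P.SolvesFreqEq ctrl exo k (hP.freq_mem k) z →
          P.errorVec ctrl exo k (hP.freq_mem k) z = 0) := by
  refine ⟨hP.existsUnique_solvesFreqEq, ?_⟩
  obtain ⟨Sig, hS⟩ := hP.sylvester
  rw [hP.robust_iff hS]
  constructor
  · intro h k z hz
    funext i
    rw [hP.errorVec_eq_errorOp hS hz i, h]
    rfl
  · intro h
    refine OutputReg.Exosystem.eq_zero_of_basis (hP.exists_errorOp_bound hS) ?_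
    rintro ⟨k, l⟩
    obtain ⟨z, hz, _⟩ := hP.existsUnique_solvesFreqEq k
    -- Φ_k lists the chain in reverse, so the basis vector with index l sits at position `l.rev`.
    have h1 := hP.errorVec_eq_errorOp hS hz l.rev
    rw [h k z hz, Fin.rev_rev] at h1
    exact h1.symm
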